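/- Let $\mathfrak g_2$ be the infinite-dimensional real Lie algebra with basis $\{X_i\}$ whose dual (Maurer–Cartan) forms $\theta_0,\dots,\theta_3,\ \xi^1,\xi^2,\xi^3,\ \sigma_{11},\sigma_{13},\sigma_{22},\sigma_{23},\sigma_{33},\ \eta_1,\eta_2,\eta_3,\dots$ satisfy the structure equations of the symmetry pseudo-group of the Boyer–Finley equation $u_{tx}=e^{u_y}u_{yy}$, $$\begin{aligned} d\theta_0&=\theta_0\wedge(\theta_3-\sigma_{33})+\xi^1\wedge\theta_1+\xi^2\wedge\theta_2+\xi^3\wedge\theta_3,\\ d\theta_1&=\eta_1\wedge\theta_1+\xi^1\wedge\sigma_{11}+\xi^2\wedge\sigma_{33}+\xi^3\wedge\sigma_{13},\\ d\theta_2&=\theta_2\wedge(\eta_1+\theta_3+\xi^3)+\xi^1\wedge\sigma_{33}+\xi^2\wedge\sigma_{22}+\xi^3\wedge\sigma_{23},\\ d\theta_3&=\xi^1\wedge\sigma_{13}+\xi^2\wedge\sigma_{23}+(\theta_3-\sigma_{33})\wedge\xi^3,\\ d\xi^1&=(\sigma_{33}-\theta_3-\eta_1)\wedge\xi^1,\qquad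 d\xi^2=(\eta_1+\sigma_{33}+\xi^3)\wedge\xi^2,\qquad d\xi^3=(\sigma_{33}-\theta_3)\wedge\xi^3,\\ d\sigma_{11}&=(2\eta_1+\theta_3-\sigma_{33})\wedge\sigma_{11}+\eta_2\wedge\xi^3+\eta_3\wedge\xi^1-\sigma_{13}\wedge\xi^2+\theta_1\wedge(\xi^2+\sigma_{13}),\\ d\sigma_{13}&=(\eta_1+\theta_3-\sigma_{33})\wedge\sigma_{13}+\eta_2\wedge\xi^1+(\theta_3-2\sigma_{33}-\xi^3)\wedge\xi^2,\\ d\sigma_{22}&=\sigma_{22}\wedge(2\eta_1+\theta_3+2\xi^3+\sigma_{33})+\eta_4\wedge\xi^3+\eta_5\wedge\xi^2+\theta_2\wedge(\xi^1+\sigma_{23})-\sigma_{23}\wedge\xi^1,\\ d\sigma_{23}&=\sigma_{23}\wedge(\eta_1+\xi^3+\sigma_{33})+\eta_4\wedge\xi^2+(\theta_3-2\sigma_{33}-\xi^3)\wedge\xi^1,\\ d\sigma_{33}&=\xi^1\wedge\sigma_{13}+\xi^2\wedge\sigma_{23}+\xi^3\wedge(\sigma_{33}-\theta_3),\qquad d\eta_1=(\sigma_{13}+\xi^2)\wedge\xi^1,\\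 d\eta_2&=\eta_6\wedge\xi^1+2(\eta_1+\theta_3-\sigma_{33})\wedge\eta_2,\\ d\eta_3&=\eta_6\wedge\xi^3+\eta_7\wedge\xi^1+(3\eta_1+2(\theta_3-\sigma_{33}))\wedge\eta_3-\eta_2\wedge(\theta_1+\xi^2)-3\sigma_{11}\wedge(\xi^2+\sigma_{13}),\\ d\eta_4&=\eta_8\wedge\xi^2-2(\eta_1+\xi^3+\sigma_{33})\wedge\eta_4,\\ d\eta_5&=\eta_8\wedge\xi^3+\eta_9\wedge\xi^2-(3\eta_1+\theta_3+3\xi^3+2\sigma_{33})\wedge\eta_5-\eta_4\wedge(\theta_2+\xi^1)-3\sigma_{22}\wedge(\xi^1+\sigma_{23}), \end{aligned}$$ together with the equations for $d\eta_6,d\eta_7,\dots$ given by the normal prolongation of this system. Explicitly: put $\zeta=\sigma_{33}-\theta_3$ and $$\begin{aligned} (a_0,a_1,a_2,a_3,a_4,\dots)&=(\xi^1,\ -(\eta_1+\theta_3-\sigma_{33}),\ -(\sigma_{13}+\xi^2),\ -\eta_2,\ -\eta_6,\ -\eta_{10},\dots),\\ (b_0,b_1,b_2,b_3,b_4,\dots)&=(\xi^2,\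 \eta_1+\sigma_{33}+\xi^3,\ -(\sigma_{23}+\xi^1),\ -\eta_4,\ -\eta_8,\ -\eta_{12},\dots),\\ (\alpha_0,\alpha_1,\alpha_2,\dots)&=(\theta_1+\xi^2,\ -\sigma_{11},\ -\eta_3,\ -\eta_7,\dots),\\ (\beta_0,\beta_1,\beta_2,\dots)&=(\theta_2+\xi^1,\ -\sigma_{22},\ -\eta_5,\ -\eta_9,\dots); \end{aligned}$$ then $da_n=\sum_{k=0}^n\binom nk a_{k+1}\wedge a_{n-k}$ and $d\alpha_n=\zeta\wedge\alpha_n-\sum_{k=0}^{n+1}\binom{n+1}k a_k\wedge\alpha_{n+1-k}-\xi^3\wedge a_{n+2}$ for all $n\ge 0$, and the same formulas hold with $(b,\beta)$ in place of $(a,\alpha)$. The bracket is given by $\omega([X,Y])=-d\omega(X,Y)$ for every Maurer–Cartan form $\omega$. Let $C^k=\mathrm{Hom}(\Lambda^k\mathfrak g_2,\mathbb R)$, with the Chevalley–Eilenberg differential $d$ with trivial coefficients and, for a closed 1-form $\omega$ and $\lambda\in\mathbb R$, the deformed differential $d_{\lambda\omega}\Theta=d\Theta+\lambda\,\omega\wedge\Theta$.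 Let $H^1(\mathfrak g_2)$ be the first cohomology for $d$, and $H^2_{\lambda\omega}(\mathfrak g_2)=\ker(d_{\lambda\omega}|_{C^2})/d_{\lambda\omega}(C^1)$. Let $I$ be the exterior ideal generated by $\theta_0,\dots,\theta_3$, $\xi^1,\xi^2,\xi^3$, $\sigma_{11},\sigma_{13},\sigma_{22},\sigma_{23},\sigma_{33}$, $\eta_1,\dots,\eta_5$, and let $H^2_{\lambda\zeta}(\mathfrak g_2)\cap I$ be the subspace of the classes that have a representative cocycle in $I$. Then: 1. $\zeta=\sigma_{33}-\theta_3$ is closed and $H^1(\mathfrak g_2)=\mathbb R\,[\zeta]$ is one-dimensional. 2. $H^2_{\lambda\zeta}(\mathfrak g_2)\cap I=0$ for every real $\lambda\ne-1$. 3. $\dim\bigl(H^2_{-\zeta}(\mathfrak g_2)\cap I\bigr)=2$; the forms $$\Omega_1=\eta_1\wedge(\xi^1+\xi^2+\xi^3)-(\theta_1+\xi^2)\wedge\xi^1+(\theta_3+\xi^3)\wedge\xi^2,\qquad \Omega_2=(\sigma_{33}-\theta_3)\wedge\xi^3$$ are $d_{-\zeta}$-cocycles lying in $I$, and $H^2_{-\zeta}(\mathfrak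 g_2)\cap I=\mathbb R[\Omega_1]\oplus\mathbb R[\Omega_2]$. -/

import Mathlib

set_option maxSynthPendingDepth 4

noncomputable section

/-! ### Exterior products of cochains in low degree -/

/-- The exterior product of two `1`-forms, as a bilinear map:
`(α ∧ β)(X, Y) = α(X) β(Y) - β(X) α(Y)`. -/
def wedge {R V : Type*} [CommRing R] [AddCommGroup V] [Module R V] (α β : V →ₗ[R] R) :
    V →ₗ[R] V →ₗ[R] R :=
  (LinearMap.lsmul R R).compl₁₂ α β - (LinearMap.lsmul R R).compl₁₂ β α

infixl:70 " ⋏ " => wedge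

theorem wedge_apply {R V : Type*} [CommRing R] [AddCommGroup V] [Module R V] (α β : V →ₗ[R] R)
    (X Y : V) : (α ⋏ β) X Y = α X * β Y - β X * α Y := by
  simp [wedge]

/-! ### Deformed cohomology of a Lie algebra

`LieModule.Cohomology.oneCochain`, `twoCochain`, `d₁₂`, `d₂₃` are the low-degree part of the
Chevalley-Eilenberg complex; here they are used with trivial coefficients in the ground ring. -/

section Deformed

open LieModule.Cohomology

variable (R : Type*) [CommRing R] (L : Type*) [LieRing L] [LieAlgebra R L]

/-- The exterior product of two `1`-cochains, as a `2`-cochain. -/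
def wedgeCochain (α β : oneCochain R L R) : twoCochain R L R :=
  ⟨α ⋏ β, fun X => by simp [wedge_apply, mul_comm]⟩

/-- `θ ↦ ω ∧ θ` on `1`-cochains. -/
def wedgeLeft₁ (ω : oneCochain R L R) : oneCochain R L R →ₗ[R] twoCochain R L R where
  toFun θ := wedgeCochain R L ω θ
  map_add' θ θ' := by
    ext X Y
    change (ω ⋏ (θ + θ')) X Y = (ω ⋏ θ) X Y + (ω ⋏ θ') X Y
    simp only [wedge_apply, LinearMap.add_apply]
    ring
  map_smul' c θ := by
    ext X Y
    change (ω ⋏ (c • θ)) X Y = c * (ω ⋏ θ) X Y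
    simp only [wedge_apply, LinearMap.smul_apply, smul_eq_mul]
    ring

/-- `Ω ↦ ω ∧ Ω` on `2`-cochains:
`(ω ∧ Ω)(X, Y, Z) = ω(X) Ω(Y, Z) - ω(Y) Ω(X, Z) + ω(Z) Ω(X, Y)`. -/
def wedgeLeft₂ (ω : oneCochain R L R) : twoCochain R L R →ₗ[R] L →ₗ[R] L →ₗ[R] L →ₗ[R] R where
  toFun Ω :=
    { toFun X :=
        { toFun Y :=
            { toFun Z := ω X * Ω Y Z - ω Y * Ω X Z + ω Z * Ω X Y
              map_add' _ _ := by simp; ring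
              map_smul' _ _ := by simp; ring }
          map_add' _ _ := by ext; simp; ring
          map_smul' _ _ := by ext; simp; ring }
      map_add' _ _ := by ext; simp; ring
      map_smul' _ _ := by ext; simp; ring }
  map_add' _ _ := by ext; simp; ring
  map_smul' _ _ := by ext; simp; ring

variable [LieRingModule L R] [LieModule R L R]

/-- The differential `C⁰(L, R) = R → C¹(L, R)`, `v ↦ (X ↦ ρ(X) v)`. -/
def d₀₁ : R →ₗ[R] oneCochain R L R where
  toFun v :=
    { toFun X := ⁅X, v⁆
      map_add' _ _ := add_lie _ _ _
      map_smul' _ _ := smul_lie _ _ _ }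
  map_add' v w := LinearMap.ext fun X => lie_add X v w
  map_smul' c v := LinearMap.ext fun X => lie_smul c X v

/-- The first cohomology `H¹(L)`: closed `1`-forms modulo the image of `C⁰(L, R)`. -/
def FirstCohomology : Type _ :=
  LinearMap.ker (d₁₂ R L R) ⧸ (LinearMap.range (d₀₁ R L)).submoduleOf (LinearMap.ker (d₁₂ R L R))

instance : AddCommGroup (FirstCohomology R L) := Submodule.Quotient.addCommGroup _

instance : Module R (FirstCohomology R L) := Submodule.Quotient.module _

/-- The class `[θ]` in `H¹(L)` of a closed `1`-form. -/
def FirstCohomology.mk (θ : oneCochain R L R) (hθ : d₁₂ R L R θ = 0) : FirstCohomology R L :=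
  Submodule.Quotient.mk ⟨θ, hθ⟩

/-- The deformed differential `θ ↦ dθ + c ω ∧ θ` on `1`-cochains. -/
def deformedD₁₂ (c : R) (ω : oneCochain R L R) : oneCochain R L R →ₗ[R] twoCochain R L R :=
  d₁₂ R L R + c • wedgeLeft₁ R L ω

/-- The deformed differential `Ω ↦ dΩ + c ω ∧ Ω` on `2`-cochains. -/
def deformedD₂₃ (c : R) (ω : oneCochain R L R) :
    twoCochain R L R →ₗ[R] L →ₗ[R] L →ₗ[R] L →ₗ[R] R :=
  d₂₃ R L R + c • wedgeLeft₂ R L ω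

/-- With trivial coefficients and for a closed `1`-form `ω` the deformed differential squares to
zero. -/
theorem deformedD₂₃_deformedD₁₂ [LieModule.IsTrivial L R] (c : R) (ω : oneCochain R L R)
    (hω : d₁₂ R L R ω = 0) (θ : oneCochain R L R) :
    deformedD₂₃ R L c ω (deformedD₁₂ R L c ω θ) = 0 := by
  have h0 : ∀ X Y, ω ⁅X, Y⁆ = 0 := fun X Y => by
    have h := d₁₂_apply_apply_ofTrivial (R := R) (L := L) (M := R) ω X Y
    rw [hω] at h
    have h' : (0 : R) = -ω ⁅X, Y⁆ := h
    rw [eq_comm, neg_eq_zero] at h'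
    exact h'
  have h1 : d₂₃ R L R (d₁₂ R L R θ) = 0 := LinearMap.congr_fun (d₂₃_comp_d₁₂ R L R) θ
  have hw : ∀ X Y, wedgeLeft₁ R L ω θ X Y = ω X * θ Y - θ X * ω Y :=
    fun X Y => wedge_apply ω θ X Y
  have hd : ∀ X Y, d₁₂ R L R θ X Y = -θ ⁅X, Y⁆ :=
    fun X Y => d₁₂_apply_apply_ofTrivial (R := R) (L := L) (M := R) θ X Y
  have hW : ∀ (Ω : twoCochain R L R) X Y Z,
      wedgeLeft₂ R L ω Ω X Y Z = ω X * Ω Y Z - ω Y * Ω X Z + ω Z * Ω X Y := fun _ _ _ _ => rfl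
  ext X Y Z
  simp only [deformedD₂₃, deformedD₁₂, LinearMap.add_apply, LinearMap.smul_apply, map_add,
    map_smul, h1, smul_eq_mul, d₂₃_apply, hW, hw, hd, trivial_lie_zero, h0, LinearMap.zero_apply]
  ring

/-- The second deformed cohomology `H²_{cω}(L)`. -/
def DeformedH2 (c : R) (ω : oneCochain R L R) : Type _ :=
  LinearMap.ker (deformedD₂₃ R L c ω) ⧸
    (LinearMap.range (deformedD₁₂ R L c ω)).submoduleOf (LinearMap.ker (deformedD₂₃ R L c ω))

instance (c : R) (ω : oneCochain R L R) : AddCommGroup (DeformedH2 R L c ω) :=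
  Submodule.Quotient.addCommGroup _

instance (c : R) (ω : oneCochain R L R) : Module R (DeformedH2 R L c ω) :=
  Submodule.Quotient.module _

/-- The class `[Ω]` in `H²_{cω}(L)` of a deformed `2`-cocycle. -/
def DeformedH2.mk (c : R) (ω : oneCochain R L R) (Ω : twoCochain R L R)
    (hΩ : deformedD₂₃ R L c ω Ω = 0) : DeformedH2 R L c ω :=
  Submodule.Quotient.mk ⟨Ω, hΩ⟩

/-- The degree-`2` component of the exterior ideal generated by a set `G` of `1`-forms. -/
def exteriorIdeal₂ (G : Set (oneCochain R L R)) : Submodule R (twoCochain R L R) :=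
  Submodule.span R {Ω | ∃ γ ∈ G, ∃ β : oneCochain R L R, Ω = wedgeCochain R L γ β}

/-- The part `H²_{cω}(L) ∩ I` of the deformed cohomology: the classes that are represented by a
cocycle lying in `I`. -/
def deformedH2Part (c : R) (ω : oneCochain R L R) (I : Submodule R (twoCochain R L R)) :
    Submodule R (DeformedH2 R L c ω) :=
  (I.submoduleOf (LinearMap.ker (deformedD₂₃ R L c ω))).map (Submodule.mkQ _)

end Deformed

/-! ### Normal prolongations -/

/-- Let `ω i` (`i : ι`) be `1`-forms graded by a level, with structure equations
`d (ω i) = d i`; the `2`-form `d i` is written as a bilinear form on the span of the dual vectors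
`X i`. The system is a normal prolongation of its part of lowest levels if for every `n`:

* for `i` of level `≤ n`, `d (ω i) = A π ∧ ω + B ω ∧ ω`, with `ω` of level `≤ n` and `π` of
  level `n + 1` (this follows from the case where the level of `i` is equal to `n`);
* the forms `χ` of level `n + 2` correspond one to one to the parameters `z` of the substitutions
  `π γ ↦ π γ + ∑ k, z γ k • ω k` that do not change the equations for `d (ω i)`, `i` of
  level `≤ n`: if `A z ω ∧ ω = 0` then there is exactly one linear combination `T` of the vectors
  dual to the `χ` such that `z γ k` is the coefficient of `T`, that is, the coefficient at
  `χ ∧ ω k` in `d (π γ)`. -/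
structure IsNormalProlongation {ι : Type*} (level : ι → ℕ)
    (d : ι → (ι →₀ ℝ) →ₗ[ℝ] (ι →₀ ℝ) →ₗ[ℝ] ℝ) : Prop where
  triangular : ∀ i j k, d i (Finsupp.single j 1) (Finsupp.single k 1) ≠ 0 →
    (level j ≤ level i ∧ level k ≤ level i + 1) ∨ (level j ≤ level i + 1 ∧ level k ≤ level i)
  complete : ∀ (n : ℕ) (z : ι → (ι →₀ ℝ)),
    (∀ k, ∀ γ ∈ (z k).support, level γ = n + 1) →
    (∀ i j k, level i ≤ n → level j ≤ n → level k ≤ n →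
      d i (z j) (Finsupp.single k 1) - d i (z k) (Finsupp.single j 1) = 0) →
    ∃! T : ι →₀ ℝ, (∀ χ ∈ T.support, level χ = n + 2) ∧
      ∀ γ k, level γ = n + 1 → level k ≤ n → z k γ = d γ T (Finsupp.single k 1)

/-! ### The structure equations of the Boyer-Finley equation -/

namespace BoyerFinley

/-- Labels of the Maurer-Cartan forms. The forms `η₂, η₃, …` are arranged in four series:
`p n`, `q n`, `r n`, `s n` are the labels of `η_{4n+2}`, `η_{4n+3}`, `η_{4n+4}`, `η_{4n+5}`. -/
inductive MC : Type
  | θ₀ | θ₁ | θ₂ | θ₃ | ξ₁ | ξ₂ | ξ₃ | σ₁₁ | σ₁₃ | σ₂₂ | σ₂₃ | σ₃₃ | η₁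
  | p (n : ℕ) | q (n : ℕ) | r (n : ℕ) | s (n : ℕ)

/-- The vector space `𝔤₂` with the basis `X i`, `i : MC`; its Lie bracket is defined below. -/
abbrev 𝔤₂ : Type := MC →₀ ℝ

/-- The Maurer-Cartan form with label `i`: the `i`-th element of the dual family,
`ω i (X j) = δ i j`. -/
def form (i : MC) : 𝔤₂ →ₗ[ℝ] ℝ := Finsupp.lapply i

abbrev θ₀ := form .θ₀
abbrev θ₁ := form .θ₁
abbrev θ₂ := form .θ₂
abbrev θ₃ := form .θ₃
abbrev ξ₁ := form .ξ₁
abbrev ξ₂ := form .ξ₂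
abbrev ξ₃ := form .ξ₃
abbrev σ₁₁ := form .σ₁₁
abbrev σ₁₃ := form .σ₁₃
abbrev σ₂₂ := form .σ₂₂
abbrev σ₂₃ := form .σ₂₃
abbrev σ₃₃ := form .σ₃₃
abbrev η₁ := form .η₁
abbrev η₂ := form (.p 0)
abbrev η₃ := form (.q 0)
abbrev η₄ := form (.r 0)
abbrev η₅ := form (.s 0)
abbrev η₆ := form (.p 1)
abbrev η₇ := form (.q 1)
abbrev η₈ := form (.r 1)
abbrev η₉ := form (.s 1)

/-- The closed form `ζ`. -/
def ζ : 𝔤₂ →ₗ[ℝ] ℝ := σ₃₃ - θ₃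

/-- Auxiliary sequence: `ξ₁`, `-(η₁ + θ₃ - σ₃₃)`, `-(σ₁₃ + ξ₂)`, `-η₂`, `-η₆`, `-η₁₀`, … -/
def a : ℕ → (𝔤₂ →ₗ[ℝ] ℝ)
  | 0 => ξ₁
  | 1 => -(η₁ + θ₃ - σ₃₃)
  | 2 => -(σ₁₃ + ξ₂)
  | n + 3 => -form (.p n)

/-- Auxiliary sequence: `ξ₂`, `η₁ + σ₃₃ + ξ₃`, `-(σ₂₃ + ξ₁)`, `-η₄`, `-η₈`, `-η₁₂`, … -/
def b : ℕ → (𝔤₂ →ₗ[ℝ] ℝ)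
  | 0 => ξ₂
  | 1 => η₁ + σ₃₃ + ξ₃
  | 2 => -(σ₂₃ + ξ₁)
  | n + 3 => -form (.r n)

/-- Auxiliary sequence: `θ₁ + ξ₂`, `-σ₁₁`, `-η₃`, `-η₇`, `-η₁₁`, … -/
def α : ℕ → (𝔤₂ →ₗ[ℝ] ℝ)
  | 0 => θ₁ + ξ₂
  | 1 => -σ₁₁
  | n + 2 => -form (.q n)

/-- Auxiliary sequence: `θ₂ + ξ₁`, `-σ₂₂`, `-η₅`, `-η₉`, `-η₁₃`, … -/
def β : ℕ → (𝔤₂ →ₗ[ℝ] ℝ)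
  | 0 => θ₂ + ξ₁
  | 1 => -σ₂₂
  | n + 2 => -form (.s n)

open Finset in
/-- `quadA u n` is the `2`-form `∑_{0 ≤ k ≤ n} C(n,k) u_{k+1} ∧ u_{n-k}`. -/
def quadA (u : ℕ → (𝔤₂ →ₗ[ℝ] ℝ)) (n : ℕ) : 𝔤₂ →ₗ[ℝ] 𝔤₂ →ₗ[ℝ] ℝ :=
  ∑ k ∈ range (n + 1), (n.choose k : ℝ) • (u (k + 1) ⋏ u (n - k))

open Finset in
/-- `quadB u v n` is the `2`-form
`ζ ∧ v_n - ∑_{0 ≤ k ≤ n+1} C(n+1,k) u_k ∧ v_{n+1-k} - ξ₃ ∧ u_{n+2}`. -/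
def quadB (u v : ℕ → (𝔤₂ →ₗ[ℝ] ℝ)) (n : ℕ) : 𝔤₂ →ₗ[ℝ] 𝔤₂ →ₗ[ℝ] ℝ :=
  ζ ⋏ v n - ∑ k ∈ range (n + 2), ((n + 1).choose k : ℝ) • (u k ⋏ v (n + 1 - k)) - ξ₃ ⋏ u (n + 2)

/-- The structure equations: `dMC i` is the differential of the form with label `i`. The equations
for `θ_i`, `ξ_j`, `σ_{ij}`, `η₁, …, η₅` are those of the symmetry pseudo-group; the equations for
`η₆, η₇, …` are those of the successive prolongations. That the system is compatible and is a normal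
prolongation is shown in `jacobi` and `isNormalProlongation` below. -/
def dMC : MC → (𝔤₂ →ₗ[ℝ] 𝔤₂ →ₗ[ℝ] ℝ)
  | .θ₀ => θ₀ ⋏ (θ₃ - σ₃₃) + ξ₁ ⋏ θ₁ + ξ₂ ⋏ θ₂ + ξ₃ ⋏ θ₃
  | .θ₁ => η₁ ⋏ θ₁ + ξ₁ ⋏ σ₁₁ + ξ₂ ⋏ σ₃₃ + ξ₃ ⋏ σ₁₃
  | .θ₂ => θ₂ ⋏ (η₁ + θ₃ + ξ₃) + ξ₁ ⋏ σ₃₃ + ξ₂ ⋏ σ₂₂ + ξ₃ ⋏ σ₂₃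
  | .θ₃ => ξ₁ ⋏ σ₁₃ + ξ₂ ⋏ σ₂₃ + (θ₃ - σ₃₃) ⋏ ξ₃
  | .ξ₁ => (σ₃₃ - θ₃ - η₁) ⋏ ξ₁
  | .ξ₂ => (η₁ + σ₃₃ + ξ₃) ⋏ ξ₂
  | .ξ₃ => (σ₃₃ - θ₃) ⋏ ξ₃
  | .σ₁₁ => ((2 : ℝ) • η₁ + θ₃ - σ₃₃) ⋏ σ₁₁ + η₂ ⋏ ξ₃ + η₃ ⋏ ξ₁ - σ₁₃ ⋏ ξ₂ + θ₁ ⋏ (ξ₂ + σ₁₃)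
  | .σ₁₃ => (η₁ + θ₃ - σ₃₃) ⋏ σ₁₃ + η₂ ⋏ ξ₁ + (θ₃ - (2 : ℝ) • σ₃₃ - ξ₃) ⋏ ξ₂
  | .σ₂₂ => σ₂₂ ⋏ ((2 : ℝ) • η₁ + θ₃ + (2 : ℝ) • ξ₃ + σ₃₃) + η₄ ⋏ ξ₃ + η₅ ⋏ ξ₂
      + θ₂ ⋏ (ξ₁ + σ₂₃) - σ₂₃ ⋏ ξ₁
  | .σ₂₃ => σ₂₃ ⋏ (η₁ + ξ₃ + σ₃₃) + η₄ ⋏ ξ₂ + (θ₃ - (2 : ℝ) • σ₃₃ - ξ₃) ⋏ ξ₁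
  | .σ₃₃ => ξ₁ ⋏ σ₁₃ + ξ₂ ⋏ σ₂₃ + ξ₃ ⋏ (σ₃₃ - θ₃)
  | .η₁ => (σ₁₃ + ξ₂) ⋏ ξ₁
  | .p 0 => η₆ ⋏ ξ₁ + (2 : ℝ) • ((η₁ + θ₃ - σ₃₃) ⋏ η₂)
  | .q 0 => η₆ ⋏ ξ₃ + η₇ ⋏ ξ₁ + ((3 : ℝ) • η₁ + (2 : ℝ) • (θ₃ - σ₃₃)) ⋏ η₃ - η₂ ⋏ (θ₁ + ξ₂)
      - (3 : ℝ) • (σ₁₁ ⋏ (ξ₂ + σ₁₃))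
  | .r 0 => η₈ ⋏ ξ₂ - (2 : ℝ) • ((η₁ + ξ₃ + σ₃₃) ⋏ η₄)
  | .s 0 => η₈ ⋏ ξ₃ + η₉ ⋏ ξ₂ - ((3 : ℝ) • η₁ + θ₃ + (3 : ℝ) • ξ₃ + (2 : ℝ) • σ₃₃) ⋏ η₅
      - η₄ ⋏ (θ₂ + ξ₁) - (3 : ℝ) • (σ₂₂ ⋏ (ξ₁ + σ₂₃))
  | .p (n + 1) => -quadA a (n + 4)
  | .q (n + 1) => -quadB a α (n + 3)
  | .r (n + 1) => -quadA b (n + 4)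
  | .s (n + 1) => -quadB b β (n + 3)

/-- The order of a form: `0` for `θ_i`, `ξ_j`, `σ_{ij}`, `1` for `η₁, …, η₅`, `2` for
`η₆, …, η₉`, `3` for `η₁₀, …, η₁₃`, and so on. -/
def level : MC → ℕ
  | .η₁ => 1
  | .p n => n + 1
  | .q n => n + 1
  | .r n => n + 1
  | .s n => n + 1
  | _ => 0

/-! #### The Lie bracket -/

open Finset in
theorem quadA_apply (u : ℕ → (𝔤₂ →ₗ[ℝ] ℝ)) (n : ℕ) (X Y : 𝔤₂) :
    quadA u n X Y = ∑ k ∈ range (n + 1),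
      (n.choose k : ℝ) * (u (k + 1) X * u (n - k) Y - u (n - k) X * u (k + 1) Y) := by
  simp [quadA, LinearMap.sum_apply, wedge_apply]

open Finset in
theorem quadB_apply (u v : ℕ → (𝔤₂ →ₗ[ℝ] ℝ)) (n : ℕ) (X Y : 𝔤₂) :
    quadB u v n X Y = (ζ X * v n Y - v n X * ζ Y) - ∑ k ∈ range (n + 2),
      ((n + 1).choose k : ℝ) * (u k X * v (n + 1 - k) Y - v (n + 1 - k) X * u k Y)
      - (ξ₃ X * u (n + 2) Y - u (n + 2) X * ξ₃ Y) := by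
  simp [quadB, LinearMap.sum_apply, wedge_apply]

theorem d_a_zero : dMC .ξ₁ = quadA a 0 := by
  refine LinearMap.ext fun X => LinearMap.ext fun Y => ?_
  simp [quadA_apply, dMC, a, wedge_apply]; ring

theorem d_a_one : -(dMC .η₁ + dMC .θ₃ - dMC .σ₃₃) = quadA a 1 := by
  refine LinearMap.ext fun X => LinearMap.ext fun Y => ?_
  simp [quadA_apply, dMC, a, wedge_apply, Finset.sum_range_succ]; ring

theorem d_a_two : -(dMC .σ₁₃ + dMC .ξ₂) = quadA a 2 := by
  refine LinearMap.ext fun X => LinearMap.ext fun Y => ?_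
  simp [quadA_apply, dMC, a, wedge_apply, Finset.sum_range_succ]; ring

theorem dMC_p (n : ℕ) : dMC (.p n) = -quadA a (n + 3) := by
  cases n with
  | zero =>
    refine LinearMap.ext fun X => LinearMap.ext fun Y => ?_
    simp [quadA_apply, dMC, a, wedge_apply, Finset.sum_range_succ, Nat.choose]; ring
  | succ n => rfl

theorem d_b_zero : dMC .ξ₂ = quadA b 0 := by
  refine LinearMap.ext fun X => LinearMap.ext fun Y => ?_
  simp [quadA_apply, dMC, b, wedge_apply]

theorem d_b_one : dMC .η₁ + dMC .σ₃₃ + dMC .ξ₃ = quadA b 1 := by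
  refine LinearMap.ext fun X => LinearMap.ext fun Y => ?_
  simp [quadA_apply, dMC, b, wedge_apply, Finset.sum_range_succ]; ring

theorem d_b_two : -(dMC .σ₂₃ + dMC .ξ₁) = quadA b 2 := by
  refine LinearMap.ext fun X => LinearMap.ext fun Y => ?_
  simp [quadA_apply, dMC, b, wedge_apply, Finset.sum_range_succ]; ring

theorem dMC_r (n : ℕ) : dMC (.r n) = -quadA b (n + 3) := by
  cases n with
  | zero =>
    refine LinearMap.ext fun X => LinearMap.ext fun Y => ?_
    simp [quadA_apply, dMC, b, wedge_apply, Finset.sum_range_succ, Nat.choose]; ring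
  | succ n => rfl

theorem d_α_zero : dMC .θ₁ + dMC .ξ₂ = quadB a α 0 := by
  refine LinearMap.ext fun X => LinearMap.ext fun Y => ?_
  simp [quadB_apply, dMC, a, α, ζ, wedge_apply, Finset.sum_range_succ]; ring

theorem d_α_one : -dMC .σ₁₁ = quadB a α 1 := by
  refine LinearMap.ext fun X => LinearMap.ext fun Y => ?_
  simp [quadB_apply, dMC, a, α, ζ, wedge_apply, Finset.sum_range_succ]; ring

theorem dMC_q (n : ℕ) : dMC (.q n) = -quadB a α (n + 2) := by
  cases n with
  | zero =>
    refine LinearMap.ext fun X => LinearMap.ext fun Y => ?_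
    simp [quadB_apply, dMC, a, α, ζ, wedge_apply, Finset.sum_range_succ, Nat.choose]; ring
  | succ n => rfl

theorem d_β_zero : dMC .θ₂ + dMC .ξ₁ = quadB b β 0 := by
  refine LinearMap.ext fun X => LinearMap.ext fun Y => ?_
  simp [quadB_apply, dMC, b, β, ζ, wedge_apply, Finset.sum_range_succ]; ring

theorem d_β_one : -dMC .σ₂₂ = quadB b β 1 := by
  refine LinearMap.ext fun X => LinearMap.ext fun Y => ?_
  simp [quadB_apply, dMC, b, β, ζ, wedge_apply, Finset.sum_range_succ]; ring

theorem dMC_s (n : ℕ) : dMC (.s n) = -quadB b β (n + 2) := by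
  cases n with
  | zero =>
    refine LinearMap.ext fun X => LinearMap.ext fun Y => ?_
    simp [quadB_apply, dMC, b, β, ζ, wedge_apply, Finset.sum_range_succ, Nat.choose]; ring
  | succ n => rfl

theorem exists_bound (X : 𝔤₂) : ∃ N, ∀ n, N ≤ n →
    a n X = 0 ∧ b n X = 0 ∧ α n X = 0 ∧ β n X = 0 := by
  obtain ⟨N, hN⟩ : ∃ N, ∀ i ∈ X.support, level i < N := by
    refine ⟨X.support.sup level + 1, fun i hi => ?_⟩
    exact Nat.lt_succ_of_le (Finset.le_sup (f := level) hi)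
  have h0 : ∀ i, N ≤ level i → X i = 0 := fun i hi => by
    by_contra h
    exact absurd (hN i (Finsupp.mem_support_iff.2 h)) (not_lt.2 hi)
  refine ⟨N + 3, fun n hn => ?_⟩
  obtain ⟨m, rfl⟩ : ∃ m, n = m + 3 := ⟨n - 3, by omega⟩
  have hm : N ≤ m := by omega
  have hp := h0 (.p m) (by simp [level]; omega)
  have hr := h0 (.r m) (by simp [level]; omega)
  have hq := h0 (.q (m + 1)) (by simp [level]; omega)
  have hs := h0 (.s (m + 1)) (by simp [level]; omega)
  simp [a, b, α, β, form, hp, hr, hq, hs]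

theorem quadA_eq_zero {u : ℕ → (𝔤₂ →ₗ[ℝ] ℝ)} {X Y : 𝔤₂} {N : ℕ}
    (h : ∀ n, N ≤ n → u n X = 0 ∧ u n Y = 0) {n : ℕ} (hn : 2 * N ≤ n) :
    quadA u n X Y = 0 := by
  rw [quadA_apply]
  refine Finset.sum_eq_zero fun k _ => ?_
  rcases le_or_gt N k with hk | hk
  · simp [h (k + 1) (by omega)]
  · simp [h (n - k) (by omega)]

theorem quadB_eq_zero {u v : ℕ → (𝔤₂ →ₗ[ℝ] ℝ)} {X Y : 𝔤₂} {N : ℕ}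
    (h : ∀ n, N ≤ n → u n X = 0 ∧ u n Y = 0) (h' : ∀ n, N ≤ n → v n X = 0 ∧ v n Y = 0)
    {n : ℕ} (hn : 2 * N ≤ n) : quadB u v n X Y = 0 := by
  rw [quadB_apply, Finset.sum_eq_zero]
  · simp [h (n + 2) (by omega), h' n (by omega)]
  · intro k _
    rcases le_or_gt N k with hk | hk
    · simp [h k (by omega)]
    · simp [h' (n + 1 - k) (by omega)]

theorem finite_level_le (N : ℕ) : {i : MC | level i ≤ N}.Finite := by
  have h : ∀ f : ℕ → MC, (f '' Set.Iic N).Finite := fun f => (Set.finite_Iic N).image f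
  refine ((Set.toFinite ({.θ₀, .θ₁, .θ₂, .θ₃, .ξ₁, .ξ₂, .ξ₃, .σ₁₁, .σ₁₃, .σ₂₂, .σ₂₃, .σ₃₃, .η₁} :
    Set MC)).union ((h .p).union ((h .q).union ((h .r).union (h .s))))).subset fun i hi => ?_
  cases i with
  | p n => exact .inr (.inl ⟨n, (Nat.le_succ n).trans hi, rfl⟩)
  | q n => exact .inr (.inr (.inl ⟨n, (Nat.le_succ n).trans hi, rfl⟩))
  | r n => exact .inr (.inr (.inr (.inl ⟨n, (Nat.le_succ n).trans hi, rfl⟩)))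
  | s n => exact .inr (.inr (.inr (.inr ⟨n, (Nat.le_succ n).trans hi, rfl⟩)))
  | _ => exact .inl (by simp)

/-- For fixed `X` and `Y` only finitely many components of the bracket are nonzero. -/
theorem finite_support (X Y : 𝔤₂) : (Function.support fun i => -dMC i X Y).Finite := by
  obtain ⟨M, hM⟩ := exists_bound X
  obtain ⟨N, hN⟩ := exists_bound Y
  have ha : ∀ n, M + N ≤ n → a n X = 0 ∧ a n Y = 0 := fun n hn =>
    ⟨(hM n (by omega)).1, (hN n (by omega)).1⟩
  have hb : ∀ n, M + N ≤ n → b n X = 0 ∧ b n Y = 0 := fun n hn =>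
    ⟨(hM n (by omega)).2.1, (hN n (by omega)).2.1⟩
  have hα : ∀ n, M + N ≤ n → α n X = 0 ∧ α n Y = 0 := fun n hn =>
    ⟨(hM n (by omega)).2.2.1, (hN n (by omega)).2.2.1⟩
  have hβ : ∀ n, M + N ≤ n → β n X = 0 ∧ β n Y = 0 := fun n hn =>
    ⟨(hM n (by omega)).2.2.2, (hN n (by omega)).2.2.2⟩
  refine (finite_level_le (2 * (M + N) + 1)).subset fun i hi => ?_
  by_contra hlt
  replace hlt : 2 * (M + N) + 1 < level i := not_le.1 hlt
  refine hi ?_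
  cases i with
  | p n => simp only [level] at hlt; simp [dMC_p, quadA_eq_zero ha (n := n + 3) (by omega)]
  | q n => simp only [level] at hlt; simp [dMC_q, quadB_eq_zero ha hα (n := n + 2) (by omega)]
  | r n => simp only [level] at hlt; simp [dMC_r, quadA_eq_zero hb (n := n + 3) (by omega)]
  | s n => simp only [level] at hlt; simp [dMC_s, quadB_eq_zero hb hβ (n := n + 2) (by omega)]
  | _ => simp [level] at hlt

/-- The bracket of `𝔤₂`: the vector `[X, Y]` with `ω i ([X, Y]) = -(d (ω i))(X, Y)` for every
Maurer-Cartan form `ω i`. -/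
def br (X Y : 𝔤₂) : 𝔤₂ := Finsupp.ofSupportFinite (fun i => -dMC i X Y) (finite_support X Y)

theorem form_br (i : MC) (X Y : 𝔤₂) : form i (br X Y) = -dMC i X Y := rfl

theorem dMC_self (i : MC) (X : 𝔤₂) : dMC i X X = 0 := by
  cases i with
  | p n => simp [dMC_p, quadA_apply, mul_comm]
  | q n => simp [dMC_q, quadB_apply, mul_comm]
  | r n => simp [dMC_r, quadA_apply, mul_comm]
  | s n => simp [dMC_s, quadB_apply, mul_comm]
  | _ => simp [dMC, wedge_apply]; try ring

theorem a_br (n : ℕ) (X Y : 𝔤₂) : a n (br X Y) = -quadA a n X Y := by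
  match n with
  | 0 => rw [← d_a_zero]; rfl
  | 1 => rw [← d_a_one]; simp [a, form_br]; ring
  | 2 => rw [← d_a_two]; simp [a, form_br]; ring
  | n + 3 => simp [a, form_br, dMC_p]

theorem b_br (n : ℕ) (X Y : 𝔤₂) : b n (br X Y) = -quadA b n X Y := by
  match n with
  | 0 => rw [← d_b_zero]; rfl
  | 1 => rw [← d_b_one]; simp [b, form_br]; ring
  | 2 => rw [← d_b_two]; simp [b, form_br]; ring
  | n + 3 => simp [b, form_br, dMC_r]

theorem α_br (n : ℕ) (X Y : 𝔤₂) : α n (br X Y) = -quadB a α n X Y := by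
  match n with
  | 0 => rw [← d_α_zero]; simp [α, form_br]; ring
  | 1 => rw [← d_α_one]; simp [α, form_br]
  | n + 2 => simp [α, form_br, dMC_q]

theorem β_br (n : ℕ) (X Y : 𝔤₂) : β n (br X Y) = -quadB b β n X Y := by
  match n with
  | 0 => rw [← d_β_zero]; simp [β, form_br]; ring
  | 1 => rw [← d_β_one]; simp [β, form_br]
  | n + 2 => simp [β, form_br, dMC_s]

theorem ζ_br (X Y : 𝔤₂) : ζ (br X Y) = 0 := by
  simp [ζ, form_br, dMC, wedge_apply]; ring

theorem ξ₃_br (X Y : 𝔤₂) : ξ₃ (br X Y) = -(ζ X * ξ₃ Y - ξ₃ X * ζ Y) := by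
  simp [ζ, form_br, dMC, wedge_apply]

theorem θ₀_br (X Y : 𝔤₂) : θ₀ (br X Y) = -(θ₀ Y * ζ X - ζ Y * θ₀ X
    + (a 0 X * α 0 Y - α 0 X * a 0 Y) + (b 0 X * β 0 Y - β 0 X * b 0 Y)
    + (ξ₃ X * (a 1 Y + b 1 Y - 2 * ζ Y) - (a 1 X + b 1 X - 2 * ζ X) * ξ₃ Y)) := by
  simp [ζ, form_br, dMC, wedge_apply, a, b, α, β]; ring

/-- A vector is determined by the values of these forms. -/
theorem ext_forms {X Y : 𝔤₂} (ha : ∀ n, a n X = a n Y) (hb : ∀ n, b n X = b n Y)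
    (hα : ∀ n, α n X = α n Y) (hβ : ∀ n, β n X = β n Y) (hζ : ζ X = ζ Y) (hξ : ξ₃ X = ξ₃ Y)
    (hθ : θ₀ X = θ₀ Y) : X = Y := by
  have hf : ∀ i Z, form i Z = Z i := fun _ _ => rfl
  have a0 := ha 0; have a1 := ha 1; have a2 := ha 2
  have b0 := hb 0; have b1 := hb 1; have b2 := hb 2
  have α0 := hα 0; have α1 := hα 1; have β0 := hβ 0; have β1 := hβ 1
  simp only [a, b, α, β, ζ, hf, LinearMap.add_apply, LinearMap.sub_apply, LinearMap.neg_apply]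
    at a0 a1 a2 b0 b1 b2 α0 α1 β0 β1 hζ hξ hθ
  ext i
  cases i with
  | p n => have := ha (n + 3); simpa [a, hf] using this
  | q n => have := hα (n + 2); simpa [α, hf] using this
  | r n => have := hb (n + 3); simpa [b, hf] using this
  | s n => have := hβ (n + 2); simpa [β, hf] using this
  | _ => linarith

/-! #### The Jacobi identity -/

open PowerSeries in
/-- The exponential generating function of the values `u n X`. -/
def gen (u : ℕ → (𝔤₂ →ₗ[ℝ] ℝ)) (X : 𝔤₂) : PowerSeries ℝ :=
  PowerSeries.mk fun n => u n X / n.factorial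

theorem gen_injective {u : ℕ → (𝔤₂ →ₗ[ℝ] ℝ)} {X Y : 𝔤₂} (h : gen u X = gen u Y) (n : ℕ) :
    u n X = u n Y := by
  have := congrArg (PowerSeries.coeff n) h
  simp only [gen, PowerSeries.coeff_mk] at this
  exact (div_left_inj' (by positivity)).1 this

theorem gen_add (u : ℕ → (𝔤₂ →ₗ[ℝ] ℝ)) (X Y : 𝔤₂) : gen u (X + Y) = gen u X + gen u Y := by
  ext n; simp [gen, add_div]

theorem coeff_gen_mul (u v : ℕ → ℝ) (n : ℕ) :
    PowerSeries.coeff n (PowerSeries.mk (fun n => u n / n.factorial) *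
      PowerSeries.mk (fun n => v n / n.factorial)) =
    (∑ k ∈ Finset.range (n + 1), (n.choose k : ℝ) * (u k * v (n - k))) / n.factorial := by
  rw [PowerSeries.coeff_mul, Finset.Nat.sum_antidiagonal_eq_sum_range_succ_mk, Finset.sum_div]
  refine Finset.sum_congr rfl fun k hk => ?_
  have hk' : k ≤ n := Nat.lt_succ_iff.1 (Finset.mem_range.1 hk)
  simp only [PowerSeries.coeff_mk]
  rw [Nat.cast_choose ℝ hk']
  have := Nat.factorial_ne_zero n
  field_simp

theorem derivative_gen (u : ℕ → ℝ) :
    PowerSeries.derivative ℝ (PowerSeries.mk fun n => u n / n.factorial) =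
      PowerSeries.mk fun n => u (n + 1) / n.factorial := by
  ext n
  rw [PowerSeries.coeff_derivative, PowerSeries.coeff_mk, PowerSeries.coeff_mk,
    Nat.factorial_succ]
  push_cast
  field_simp

open PowerSeries in
theorem gen_quadA (u : ℕ → (𝔤₂ →ₗ[ℝ] ℝ)) (X Y : 𝔤₂) :
    PowerSeries.mk (fun n => quadA u n X Y / n.factorial) =
      derivative ℝ (gen u X) * gen u Y - derivative ℝ (gen u Y) * gen u X := by
  ext n
  rw [gen, gen, derivative_gen fun n => u n X, derivative_gen fun n => u n Y, map_sub,
    coeff_gen_mul (fun n => u (n + 1) X), coeff_gen_mul (fun n => u (n + 1) Y), coeff_mk,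
    ← sub_div, ← Finset.sum_sub_distrib, quadA_apply]
  congr 1
  exact Finset.sum_congr rfl fun k _ => by ring

open PowerSeries in
theorem gen_quadB (u v : ℕ → (𝔤₂ →ₗ[ℝ] ℝ)) (X Y : 𝔤₂) :
    PowerSeries.mk (fun n => quadB u v n X Y / n.factorial) =
      (C (ζ X) * gen v Y - C (ζ Y) * gen v X)
      - derivative ℝ (gen u X * gen v Y - gen u Y * gen v X)
      - (C (ξ₃ X) * derivative ℝ (derivative ℝ (gen u Y))
        - C (ξ₃ Y) * derivative ℝ (derivative ℝ (gen u X))) := by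
  ext n
  simp only [gen]
  rw [derivative_gen fun n => u n X, derivative_gen fun n => u n Y,
    derivative_gen fun n => u (n + 1) X, derivative_gen fun n => u (n + 1) Y]
  simp only [map_sub, coeff_C_mul, coeff_derivative]
  rw [coeff_gen_mul (fun n => u n X), coeff_gen_mul (fun n => u n Y)]
  simp only [coeff_mk, quadB_apply]
  have h : (∑ k ∈ Finset.range (n + 2), ((n + 1).choose k : ℝ) *
      (u k X * v (n + 1 - k) Y - v (n + 1 - k) X * u k Y)) =
      (∑ k ∈ Finset.range (n + 1 + 1), ((n + 1).choose k : ℝ) * (u k X * v (n + 1 - k) Y)) -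
      ∑ k ∈ Finset.range (n + 1 + 1), ((n + 1).choose k : ℝ) * (u k Y * v (n + 1 - k) X) := by
    rw [← Finset.sum_sub_distrib]
    exact Finset.sum_congr rfl fun k _ => by ring
  rw [h, Nat.factorial_succ]
  push_cast
  field_simp

theorem gen_br {u : ℕ → (𝔤₂ →ₗ[ℝ] ℝ)} (hu : ∀ n X Y, u n (br X Y) = -quadA u n X Y)
    (X Y : 𝔤₂) : gen u (br X Y) = -(PowerSeries.derivative ℝ (gen u X) * gen u Y -
      PowerSeries.derivative ℝ (gen u Y) * gen u X) := by
  rw [← gen_quadA]; ext n; simp [gen, hu, neg_div]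

open PowerSeries in
theorem gen_br' {u v : ℕ → (𝔤₂ →ₗ[ℝ] ℝ)} (hv : ∀ n X Y, v n (br X Y) = -quadB u v n X Y)
    (X Y : 𝔤₂) : gen v (br X Y) = -((C (ζ X) * gen v Y - C (ζ Y) * gen v X)
      - derivative ℝ (gen u X * gen v Y - gen u Y * gen v X)
      - (C (ξ₃ X) * derivative ℝ (derivative ℝ (gen u Y))
        - C (ξ₃ Y) * derivative ℝ (derivative ℝ (gen u X)))) := by
  rw [← gen_quadB]; ext n; simp [gen, hv, neg_div]

theorem jacobi_A {u : ℕ → (𝔤₂ →ₗ[ℝ] ℝ)} (hu : ∀ n X Y, u n (br X Y) = -quadA u n X Y)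
    (X Y Z : 𝔤₂) (n : ℕ) : u n (br X (br Y Z)) = u n (br (br X Y) Z + br Y (br X Z)) := by
  refine gen_injective (u := u) ?_ n
  simp only [gen_add, gen_br hu, Derivation.leibniz, map_neg, map_sub, smul_eq_mul]
  ring

open PowerSeries in
theorem jacobi_B {u v : ℕ → (𝔤₂ →ₗ[ℝ] ℝ)} (hu : ∀ n X Y, u n (br X Y) = -quadA u n X Y)
    (hv : ∀ n X Y, v n (br X Y) = -quadB u v n X Y)
    (X Y Z : 𝔤₂) (n : ℕ) : v n (br X (br Y Z)) = v n (br (br X Y) Z + br Y (br X Z)) := by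
  refine gen_injective (u := v) ?_ n
  have hC : ∀ c : ℝ, derivative ℝ (C c) = 0 := fun c => derivative_C
  simp only [gen_add, gen_br hu, gen_br' hv, ζ_br, ξ₃_br, Derivation.leibniz, map_neg, map_sub,
    map_add, map_mul, map_zero, smul_eq_mul, hC]
  ring

theorem jacobi (X Y Z : 𝔤₂) : br X (br Y Z) = br (br X Y) Z + br Y (br X Z) := by
  refine ext_forms (jacobi_A a_br X Y Z) (jacobi_A b_br X Y Z) (jacobi_B a_br α_br X Y Z)
    (jacobi_B b_br β_br X Y Z) ?_ ?_ ?_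
  · simp only [map_add, ζ_br, add_zero]
  · simp only [map_add, ζ_br, ξ₃_br]; ring
  · simp only [map_add, ζ_br, ξ₃_br, θ₀_br, a_br, b_br, α_br, β_br, quadA_apply, quadB_apply,
      Finset.sum_range_succ, Finset.sum_range_zero]
    norm_num
    ring

instance : LieRing 𝔤₂ where
  bracket := br
  add_lie X Y Z := Finsupp.ext fun i => by
    change -dMC i (X + Y) Z = -dMC i X Z + -dMC i Y Z
    rw [map_add, LinearMap.add_apply]; ring
  lie_add X Y Z := Finsupp.ext fun i => by
    change -dMC i X (Y + Z) = -dMC i X Y + -dMC i X Z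
    rw [map_add]; ring
  lie_self X := Finsupp.ext fun i => by
    change -dMC i X X = 0
    rw [dMC_self, neg_zero]
  leibniz_lie := jacobi

instance : LieAlgebra ℝ 𝔤₂ where
  lie_smul c X Y := Finsupp.ext fun i => by
    change -dMC i X (c • Y) = c * -dMC i X Y
    rw [map_smul, smul_eq_mul]; ring

/-- The bracket is dual to the structure equations: `ω i ([X, Y]) = -(d (ω i))(X, Y)`. -/
theorem form_lie (i : MC) (X Y : 𝔤₂) : form i ⁅X, Y⁆ = -dMC i X Y := rfl

/-- The trivial representation of `𝔤₂` on `ℝ`. -/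
instance : LieRingModule 𝔤₂ ℝ where
  bracket _ _ := 0
  add_lie _ _ _ := (add_zero 0).symm
  lie_add _ _ _ := (add_zero 0).symm
  leibniz_lie _ _ _ := (add_zero 0).symm

instance : LieModule ℝ 𝔤₂ ℝ where
  smul_lie _ _ _ := (smul_zero _).symm
  lie_smul _ _ _ := (smul_zero _).symm

instance : LieModule.IsTrivial 𝔤₂ ℝ := ⟨fun _ _ => rfl⟩

/-! #### The prolongation is normal -/

/-- The `1`-form `γ` involves only forms of level `≤ n`. -/
def Lev (n : ℕ) (γ : 𝔤₂ →ₗ[ℝ] ℝ) : Prop := ∀ j, n < level j → γ (Finsupp.single j 1) = 0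

theorem Lev.form {n : ℕ} {i : MC} (h : level i ≤ n) : Lev n (form i) := fun j hj => by
  have : j ≠ i := by rintro rfl; omega
  simp [BoyerFinley.form, this]

theorem Lev.add {n : ℕ} {γ δ : 𝔤₂ →ₗ[ℝ] ℝ} (h : Lev n γ) (h' : Lev n δ) : Lev n (γ + δ) :=
  fun j hj => by simp [h j hj, h' j hj]

theorem Lev.sub {n : ℕ} {γ δ : 𝔤₂ →ₗ[ℝ] ℝ} (h : Lev n γ) (h' : Lev n δ) : Lev n (γ - δ) :=
  fun j hj => by simp [h j hj, h' j hj]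

theorem Lev.neg {n : ℕ} {γ : 𝔤₂ →ₗ[ℝ] ℝ} (h : Lev n γ) : Lev n (-γ) :=
  fun j hj => by simp [h j hj]

theorem Lev.smul {n : ℕ} {γ : 𝔤₂ →ₗ[ℝ] ℝ} (c : ℝ) (h : Lev n γ) : Lev n (c • γ) :=
  fun j hj => by simp [h j hj]

theorem Lev.mono {m n : ℕ} {γ : 𝔤₂ →ₗ[ℝ] ℝ} (h : Lev m γ) (hmn : m ≤ n) : Lev n γ :=
  fun j hj => h j (by omega)

theorem lev_a (n : ℕ) : Lev (max 1 (n - 2)) (a n) := by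
  match n with
  | 0 => exact Lev.form (by simp [level])
  | 1 =>
    exact (((Lev.form (by simp [level])).add (Lev.form (by simp [level]))).sub
      (Lev.form (by simp [level]))).neg
  | 2 => exact ((Lev.form (by simp [level])).add (Lev.form (by simp [level]))).neg
  | n + 3 => exact (Lev.form (by simp [level])).neg

theorem lev_b (n : ℕ) : Lev (max 1 (n - 2)) (b n) := by
  match n with
  | 0 => exact Lev.form (by simp [level])
  | 1 =>
    exact ((Lev.form (by simp [level])).add (Lev.form (by simp [level]))).add
      (Lev.form (by simp [level]))
  | 2 => exact ((Lev.form (by simp [level])).add (Lev.form (by simp [level]))).neg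
  | n + 3 => exact (Lev.form (by simp [level])).neg

theorem lev_α (n : ℕ) : Lev (n - 1) (α n) := by
  match n with
  | 0 => exact (Lev.form (by simp [level])).add (Lev.form (by simp [level]))
  | 1 => exact (Lev.form (by simp [level])).neg
  | n + 2 => exact (Lev.form (by simp [level])).neg

theorem lev_β (n : ℕ) : Lev (n - 1) (β n) := by
  match n with
  | 0 => exact (Lev.form (by simp [level])).add (Lev.form (by simp [level]))
  | 1 => exact (Lev.form (by simp [level])).neg
  | n + 2 => exact (Lev.form (by simp [level])).neg

theorem lev_ζ (n : ℕ) : Lev n ζ :=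
  (Lev.form (by simp [level])).sub (Lev.form (by simp [level]))

/-- The `2`-form `B` is of the form `A π ∧ ω + B ω ∧ ω`, with `ω` of level `≤ n` and `π` of
level `n + 1`. -/
def Tri (n : ℕ) (B : 𝔤₂ →ₗ[ℝ] 𝔤₂ →ₗ[ℝ] ℝ) : Prop :=
  ∀ j k, B (Finsupp.single j 1) (Finsupp.single k 1) ≠ 0 →
    (level j ≤ n ∧ level k ≤ n + 1) ∨ (level j ≤ n + 1 ∧ level k ≤ n)

theorem Tri.wedge {n : ℕ} {γ δ : 𝔤₂ →ₗ[ℝ] ℝ}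
    (h : (Lev n γ ∧ Lev (n + 1) δ) ∨ (Lev (n + 1) γ ∧ Lev n δ)) : Tri n (γ ⋏ δ) := by
  intro j k hjk
  by_contra hc
  refine hjk ?_
  rw [wedge_apply]
  rcases h with ⟨h, h'⟩ | ⟨h, h'⟩
  · have h1 : γ (Finsupp.single j 1) = 0 ∨ δ (Finsupp.single k 1) = 0 := by
      by_cases hj : n < level j
      · exact .inl (h j hj)
      · exact .inr (h' k (by omega))
    have h2 : γ (Finsupp.single k 1) = 0 ∨ δ (Finsupp.single j 1) = 0 := by
      by_cases hj : n < level k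
      · exact .inl (h k hj)
      · exact .inr (h' j (by omega))
    rcases h1 with h1 | h1 <;> rcases h2 with h2 | h2 <;> simp [h1, h2]
  · have h1 : γ (Finsupp.single j 1) = 0 ∨ δ (Finsupp.single k 1) = 0 := by
      by_cases hj : n < level k
      · exact .inr (h' k hj)
      · exact .inl (h j (by omega))
    have h2 : γ (Finsupp.single k 1) = 0 ∨ δ (Finsupp.single j 1) = 0 := by
      by_cases hj : n < level j
      · exact .inr (h' j hj)
      · exact .inl (h k (by omega))
    rcases h1 with h1 | h1 <;> rcases h2 with h2 | h2 <;> simp [h1, h2]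

theorem Tri.add {n : ℕ} {B C : 𝔤₂ →ₗ[ℝ] 𝔤₂ →ₗ[ℝ] ℝ} (h : Tri n B) (h' : Tri n C) :
    Tri n (B + C) := fun j k hjk => by
  by_contra hc
  have h1 := not_imp_comm.1 (h j k) hc
  have h2 := not_imp_comm.1 (h' j k) hc
  exact hjk (by simp [h1, h2])

theorem Tri.smul {n : ℕ} {B : 𝔤₂ →ₗ[ℝ] 𝔤₂ →ₗ[ℝ] ℝ} (c : ℝ) (h : Tri n B) : Tri n (c • B) :=
  fun j k hjk => h j k fun h0 => hjk (by simp [h0])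

theorem Tri.neg {n : ℕ} {B : 𝔤₂ →ₗ[ℝ] 𝔤₂ →ₗ[ℝ] ℝ} (h : Tri n B) : Tri n (-B) := by
  simpa using h.smul (-1)

theorem Tri.sub {n : ℕ} {B C : 𝔤₂ →ₗ[ℝ] 𝔤₂ →ₗ[ℝ] ℝ} (h : Tri n B) (h' : Tri n C) :
    Tri n (B - C) := by
  rw [sub_eq_add_neg]; exact h.add h'.neg

theorem Tri.sum {n : ℕ} {s : Finset ℕ} {B : ℕ → 𝔤₂ →ₗ[ℝ] 𝔤₂ →ₗ[ℝ] ℝ}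
    (h : ∀ k ∈ s, Tri n (B k)) : Tri n (∑ k ∈ s, B k) :=
  Finset.sum_induction B (Tri n) (fun _ _ => Tri.add) (fun _ _ h => absurd rfl h) h

theorem tri_quadA {u : ℕ → (𝔤₂ →ₗ[ℝ] ℝ)} (hu : ∀ n, Lev (max 1 (n - 2)) (u n))
    (h0 : Lev 0 (u 0)) (n : ℕ) : Tri (n + 1) (quadA u (n + 3)) := by
  refine Tri.sum fun k hk => Tri.smul _ (Tri.wedge ?_)
  have hk' := Finset.mem_range.1 hk
  rcases Nat.lt_or_ge k (n + 3) with h | h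
  · exact .inl ⟨(hu _).mono (by omega), (hu _).mono (by omega)⟩
  · obtain rfl : k = n + 3 := by omega
    rw [Nat.sub_self]
    exact .inr ⟨(hu _).mono (by omega), h0.mono (by omega)⟩

theorem tri_quadB {u v : ℕ → (𝔤₂ →ₗ[ℝ] ℝ)} (hu : ∀ n, Lev (max 1 (n - 2)) (u n))
    (h0 : Lev 0 (u 0)) (hv : ∀ n, Lev (n - 1) (v n)) (n : ℕ) :
    Tri (n + 1) (quadB u v (n + 2)) := by
  refine ((Tri.wedge ?_).sub (Tri.sum fun k hk => Tri.smul _ (Tri.wedge ?_))).sub (Tri.wedge ?_)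
  · exact .inl ⟨lev_ζ _, (hv _).mono (by omega)⟩
  · have hk' := Finset.mem_range.1 hk
    cases k with
    | zero => exact .inl ⟨h0.mono (by omega), (hv _).mono (by omega)⟩
    | succ k => exact .inr ⟨(hu _).mono (by omega), (hv _).mono (by omega)⟩
  · exact .inl ⟨Lev.form (by simp [level]), (hu _).mono (by omega)⟩

theorem tri_dMC (i : MC) : Tri (level i) (dMC i) := by
  have ha0 : Lev 0 (a 0) := Lev.form (by simp [level])
  have hb0 : Lev 0 (b 0) := Lev.form (by simp [level])
  cases i with
  | p n => rw [dMC_p]; exact (tri_quadA lev_a ha0 n).neg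
  | q n => rw [dMC_q]; exact (tri_quadB lev_a ha0 lev_α n).neg
  | r n => rw [dMC_r]; exact (tri_quadA lev_b hb0 n).neg
  | s n => rw [dMC_s]; exact (tri_quadB lev_b hb0 lev_β n).neg
  | _ =>
    simp only [dMC, level]
    repeat' first
      | apply Tri.wedge
      | apply Tri.add
      | apply Tri.sub
    all_goals first
      | (refine Or.inl (And.intro ?_ ?_) <;> (repeat' first | apply Lev.add | apply Lev.sub | apply Lev.smul) <;>
          (first | exact Lev.form (Nat.zero_le _) | exact Lev.form (Nat.le_refl _)))
      | (refine Or.inr (And.intro ?_ ?_) <;> (repeat' first | apply Lev.add | apply Lev.sub | apply Lev.smul) <;>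
          (first | exact Lev.form (Nat.zero_le _) | exact Lev.form (Nat.le_refl _)))

open Finset in
/-- Only the top terms of `quadA` contribute if `Z` is of high level and `X` of low level. -/
theorem quadA_top {u : ℕ → (𝔤₂ →ₗ[ℝ] ℝ)} {n : ℕ} {Z X : 𝔤₂} (hZ : ∀ m, m ≤ n → u m Z = 0)
    (hX : u (n + 1) X = 0) : quadA u n Z X = u (n + 1) Z * u 0 X := by
  rw [quadA_apply, sum_eq_single n]
  · simp [hX]
  · intro k hk hkn
    have : k ≤ n := Nat.lt_succ_iff.1 (mem_range.1 hk)
    simp [hZ (k + 1) (by omega), hZ (n - k) (by omega)]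
  · simp

open Finset in
theorem quadB_top {u v : ℕ → (𝔤₂ →ₗ[ℝ] ℝ)} {n : ℕ} {Z X : 𝔤₂}
    (hu : ∀ m, m ≤ n + 1 → u m Z = 0) (hv : ∀ m, m ≤ n → v m Z = 0) (hζ : ζ Z = 0)
    (hξ : ξ₃ Z = 0) (hX : u (n + 2) X = 0) :
    quadB u v n Z X = v (n + 1) Z * u 0 X + u (n + 2) Z * ξ₃ X := by
  rw [quadB_apply, sum_eq_single 0]
  · simp [hζ, hξ, hv n le_rfl, hu 0 (by omega), hX]
  · intro k hk hk0
    have : k < n + 2 := mem_range.1 hk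
    simp [hu k (by omega), hv (n + 1 - k) (by omega)]
  · simp

theorem form_apply (i : MC) (X : 𝔤₂) : form i X = X i := rfl

theorem eval_high {m n : ℕ} {γ : 𝔤₂ →ₗ[ℝ] ℝ} (hγ : Lev m γ) {Z : 𝔤₂}
    (hZ : ∀ i ∈ Z.support, level i = n) (hmn : m < n) : γ Z = 0 := by
  have : γ Z = Z.sum fun i c => γ (Finsupp.single i c) := by
    conv_lhs => rw [← Finsupp.sum_single Z]
    rw [map_finsuppSum]
  rw [this]
  refine Finset.sum_eq_zero fun i hi => ?_
  have h : γ (Finsupp.single i (Z i)) = Z i * γ (Finsupp.single i 1) := by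
    rw [← smul_eq_mul, ← map_smul, Finsupp.smul_single, smul_eq_mul, mul_one]
  change γ (Finsupp.single i (Z i)) = 0
  rw [h, hγ i (by rw [hZ i hi]; exact hmn), mul_zero]

theorem high_forms {N : ℕ} {Z : 𝔤₂} (hZ : ∀ i, level i ≠ N + 1 → Z i = 0) (hη : Z .η₁ = 0) :
    (∀ m, m ≤ N + 2 → a m Z = 0) ∧ (∀ m, m ≤ N + 2 → b m Z = 0) ∧
    (∀ m, m ≤ N + 1 → α m Z = 0) ∧ (∀ m, m ≤ N + 1 → β m Z = 0) ∧ ζ Z = 0 ∧ ξ₃ Z = 0 := by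
  have h0 : ∀ i, level i = 0 → Z i = 0 := fun i hi => hZ i (by omega)
  have hl : ∀ i, level i ≤ N → Z i = 0 := fun i hi => hZ i (by omega)
  refine ⟨fun m hm => ?_, fun m hm => ?_, fun m hm => ?_, fun m hm => ?_, ?_, ?_⟩
  · match m with
    | 0 => exact h0 _ rfl
    | 1 => simp [a, form_apply, hη, h0 .θ₃ rfl, h0 .σ₃₃ rfl]
    | 2 => simp [a, form_apply, h0 .σ₁₃ rfl, h0 .ξ₂ rfl]
    | m + 3 => simp [a, form_apply, hl (.p m) (by simp only [level]; omega)]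
  · match m with
    | 0 => exact h0 _ rfl
    | 1 => simp [b, form_apply, hη, h0 .ξ₃ rfl, h0 .σ₃₃ rfl]
    | 2 => simp [b, form_apply, h0 .σ₂₃ rfl, h0 .ξ₁ rfl]
    | m + 3 => simp [b, form_apply, hl (.r m) (by simp only [level]; omega)]
  · match m with
    | 0 => simp [α, form_apply, h0 .θ₁ rfl, h0 .ξ₂ rfl]
    | 1 => simp [α, form_apply, h0 .σ₁₁ rfl]
    | m + 2 => simp [α, form_apply, hl (.q m) (by simp only [level]; omega)]
  · match m with
    | 0 => simp [β, form_apply, h0 .θ₂ rfl, h0 .ξ₁ rfl]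
    | 1 => simp [β, form_apply, h0 .σ₂₂ rfl]
    | m + 2 => simp [β, form_apply, hl (.s m) (by simp only [level]; omega)]
  · simp [ζ, form_apply, h0 .σ₃₃ rfl, h0 .θ₃ rfl]
  · exact h0 _ rfl

theorem low_forms {n : ℕ} {k : MC} (hk : level k ≤ n) :
    (∀ m, n ≤ m → a (m + 3) (Finsupp.single k 1) = 0 ∧ b (m + 3) (Finsupp.single k 1) = 0 ∧
      α (m + 2) (Finsupp.single k 1) = 0 ∧ β (m + 2) (Finsupp.single k 1) = 0) := by
  intro m hm
  have h : ∀ i, level i = m + 1 → (Finsupp.single k (1 : ℝ)) i = 0 := fun i hi => by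
    have hne : i ≠ k := by rintro rfl; omega
    simp [hne]
  simp [a, b, α, β, form_apply, h (.p m) rfl, h (.q m) rfl, h (.r m) rfl, h (.s m) rfl]

theorem eta_one_eq_zero {n : ℕ} {z : MC → 𝔤₂} (hz : ∀ k i, level i ≠ n + 1 → z k i = 0)
    (hc : ∀ i j k, level i ≤ n → level j ≤ n → level k ≤ n →
      dMC i (z j) (Finsupp.single k 1) - dMC i (z k) (Finsupp.single j 1) = 0)
    {j : MC} (hj : level j ≤ n) : z j .η₁ = 0 := by
  cases n with
  | succ n => exact hz j _ (by simp [level])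
  | zero =>
    have h0 : ∀ k i, level i = 0 → z k i = 0 := fun k i hi => hz k i (by omega)
    have h1 : ∀ j, level j ≤ 0 →
        z j .η₁ = z .ξ₁ .η₁ * (Finsupp.single j (1 : ℝ)) MC.ξ₁ := fun j hj => by
      have := hc .ξ₁ j .ξ₁ le_rfl hj le_rfl
      simp [dMC, wedge_apply, form_apply, h0 _ .σ₃₃ rfl, h0 _ .θ₃ rfl, h0 _ .ξ₁ rfl] at this
      linarith
    have h2 := hc .ξ₂ .ξ₁ .ξ₂ le_rfl le_rfl le_rfl
    simp [dMC, wedge_apply, form_apply, h0 _ .σ₃₃ rfl, h0 _ .ξ₃ rfl, h0 _ .ξ₂ rfl] at h2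
    rw [h1 j hj, h2, zero_mul]

/-- The system of structure equations is a normal prolongation. -/
theorem isNormalProlongation : IsNormalProlongation level dMC where
  triangular i j k h := tri_dMC i j k h
  complete n z hz hc := by
    replace hz : ∀ k i, level i ≠ n + 1 → z k i = 0 := fun k i hi => by
      by_contra h
      exact hi (hz k i (Finsupp.mem_support_iff.2 h))
    have hη : ∀ j, level j ≤ n → z j .η₁ = 0 := fun j hj => eta_one_eq_zero hz hc hj
    have qa : ∀ j k, level j ≤ n → level k ≤ n →
        quadA a (n + 2) (z j) (Finsupp.single k 1) - quadA a (n + 2) (z k) (Finsupp.single j 1)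
          = 0 := fun j k hj hk => by
      cases n with
      | zero =>
        have h1 := hc .σ₁₃ j k le_rfl hj hk
        have h2 := hc .ξ₂ j k le_rfl hj hk
        rw [← d_a_two]
        simp only [LinearMap.neg_apply, LinearMap.add_apply]
        linarith
      | succ n =>
        have h1 := hc (.p n) j k le_rfl hj hk
        rw [dMC_p] at h1
        simp only [LinearMap.neg_apply] at h1
        linarith
    have qb : ∀ j k, level j ≤ n → level k ≤ n →
        quadA b (n + 2) (z j) (Finsupp.single k 1) - quadA b (n + 2) (z k) (Finsupp.single j 1)
          = 0 := fun j k hj hk => by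
      cases n with
      | zero =>
        have h1 := hc .σ₂₃ j k le_rfl hj hk
        have h2 := hc .ξ₁ j k le_rfl hj hk
        rw [← d_b_two]
        simp only [LinearMap.neg_apply, LinearMap.add_apply]
        linarith
      | succ n =>
        have h1 := hc (.r n) j k le_rfl hj hk
        rw [dMC_r] at h1
        simp only [LinearMap.neg_apply] at h1
        linarith
    have qα : ∀ j k, level j ≤ n → level k ≤ n →
        quadB a α (n + 1) (z j) (Finsupp.single k 1)
          - quadB a α (n + 1) (z k) (Finsupp.single j 1) = 0 := fun j k hj hk => by
      cases n with
      | zero =>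
        have h1 := hc .σ₁₁ j k le_rfl hj hk
        rw [← d_α_one]
        simp only [LinearMap.neg_apply]
        linarith
      | succ n =>
        have h1 := hc (.q n) j k le_rfl hj hk
        rw [dMC_q] at h1
        simp only [LinearMap.neg_apply] at h1
        linarith
    have qβ : ∀ j k, level j ≤ n → level k ≤ n →
        quadB b β (n + 1) (z j) (Finsupp.single k 1)
          - quadB b β (n + 1) (z k) (Finsupp.single j 1) = 0 := fun j k hj hk => by
      cases n with
      | zero =>
        have h1 := hc .σ₂₂ j k le_rfl hj hk
        rw [← d_β_one]
        simp only [LinearMap.neg_apply]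
        linarith
      | succ n =>
        have h1 := hc (.s n) j k le_rfl hj hk
        rw [dMC_s] at h1
        simp only [LinearMap.neg_apply] at h1
        linarith
    -- evaluation of the equations of level `n + 1` on vectors of level `n + 2`
    have ev : ∀ T : 𝔤₂, (∀ i, level i ≠ n + 2 → T i = 0) → ∀ k, level k ≤ n →
        dMC (.p n) T (Finsupp.single k 1) = T (.p (n + 1)) * ξ₁ (Finsupp.single k 1) ∧
        dMC (.r n) T (Finsupp.single k 1) = T (.r (n + 1)) * ξ₂ (Finsupp.single k 1) ∧
        dMC (.q n) T (Finsupp.single k 1) = T (.q (n + 1)) * ξ₁ (Finsupp.single k 1)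
          + T (.p (n + 1)) * ξ₃ (Finsupp.single k 1) ∧
        dMC (.s n) T (Finsupp.single k 1) = T (.s (n + 1)) * ξ₂ (Finsupp.single k 1)
          + T (.r (n + 1)) * ξ₃ (Finsupp.single k 1) := by
      intro T hT k hk
      obtain ⟨h1, h2, h3, h4, h5, h6⟩ := high_forms (N := n + 1) hT (hT _ (by simp [level]))
      obtain ⟨l1, l2, l3, l4⟩ := low_forms hk (n + 1) (by omega)
      rw [dMC_p, dMC_q, dMC_r, dMC_s]
      simp only [LinearMap.neg_apply]
      rw [quadA_top h1 l1, quadA_top h2 l2, quadB_top h1 h3 h5 h6 l1,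
        quadB_top h2 h4 h5 h6 l2]
      simp only [a, b, α, β, LinearMap.neg_apply, form_apply]
      refine ⟨?_, ?_, ?_, ?_⟩ <;> ring
    -- the solutions `z`
    have sol : ∀ k, level k ≤ n →
        z k (.p n) = z .ξ₁ (.p n) * ξ₁ (Finsupp.single k 1) ∧
        z k (.r n) = z .ξ₂ (.r n) * ξ₂ (Finsupp.single k 1) ∧
        z k (.q n) = z .ξ₁ (.q n) * ξ₁ (Finsupp.single k 1)
          + z .ξ₁ (.p n) * ξ₃ (Finsupp.single k 1) ∧
        z k (.s n) = z .ξ₂ (.s n) * ξ₂ (Finsupp.single k 1)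
          + z .ξ₂ (.r n) * ξ₃ (Finsupp.single k 1) := by
      intro k hk
      have l0 : level .ξ₁ ≤ n := Nat.zero_le _
      have l0' : level .ξ₂ ≤ n := Nat.zero_le _
      have eA : ∀ i j, level i ≤ n → level j ≤ n →
          quadA a (n + 2) (z i) (Finsupp.single j 1) = -z i (.p n) * ξ₁ (Finsupp.single j 1) ∧
          quadA b (n + 2) (z i) (Finsupp.single j 1) = -z i (.r n) * ξ₂ (Finsupp.single j 1) ∧
          quadB a α (n + 1) (z i) (Finsupp.single j 1) = -z i (.q n) * ξ₁ (Finsupp.single j 1)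
            - z i (.p n) * ξ₃ (Finsupp.single j 1) ∧
          quadB b β (n + 1) (z i) (Finsupp.single j 1) = -z i (.s n) * ξ₂ (Finsupp.single j 1)
            - z i (.r n) * ξ₃ (Finsupp.single j 1) := by
        intro i j hi hj
        obtain ⟨h1, h2, h3, h4, h5, h6⟩ := high_forms (hz i) (hη i hi)
        obtain ⟨l1, l2, l3, l4⟩ := low_forms hj n le_rfl
        rw [quadA_top h1 l1, quadA_top h2 l2, quadB_top h1 h3 h5 h6 l1,
          quadB_top h2 h4 h5 h6 l2]
        simp only [a, b, α, β, LinearMap.neg_apply, form_apply]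
        refine ⟨?_, ?_, ?_, ?_⟩ <;> first | trivial | rw [sub_eq_add_neg, neg_mul (z i (.p n))] | rw [sub_eq_add_neg, neg_mul (z i (.r n))]
      have e1 := qa k .ξ₁ hk l0
      have e2 := qb k .ξ₂ hk l0'
      have e3 := qα k .ξ₁ hk l0
      have e4 := qβ k .ξ₂ hk l0'
      rw [(eA _ _ hk l0).1, (eA _ _ l0 hk).1] at e1
      rw [(eA _ _ hk l0').2.1, (eA _ _ l0' hk).2.1] at e2
      rw [(eA _ _ hk l0).2.2.1, (eA _ _ l0 hk).2.2.1] at e3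
      rw [(eA _ _ hk l0').2.2.2, (eA _ _ l0' hk).2.2.2] at e4
      have s11 : ξ₁ (Finsupp.single .ξ₁ 1) = 1 := by simp [form]
      have s22 : ξ₂ (Finsupp.single .ξ₂ 1) = 1 := by simp [form]
      have s31 : ξ₃ (Finsupp.single .ξ₁ 1) = 0 := by simp [form]
      have s32 : ξ₃ (Finsupp.single .ξ₂ 1) = 0 := by simp [form]
      rw [s11] at e1; rw [s22] at e2; rw [s11, s31] at e3; rw [s22, s32] at e4
      refine ⟨?_, ?_, ?_, ?_⟩ <;> linarith
    have supp : ∀ T : 𝔤₂, (∀ χ ∈ T.support, level χ = n + 2) →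
        ∀ i, level i ≠ n + 2 → T i = 0 := fun T hT i hi => by
      by_contra h
      exact hi (hT i (Finsupp.mem_support_iff.2 h))
    let T : 𝔤₂ := Finsupp.single (.p (n + 1)) (z .ξ₁ (.p n))
      + Finsupp.single (.q (n + 1)) (z .ξ₁ (.q n)) + Finsupp.single (.r (n + 1)) (z .ξ₂ (.r n))
      + Finsupp.single (.s (n + 1)) (z .ξ₂ (.s n))
    have hTp : T (.p (n + 1)) = z .ξ₁ (.p n) := by simp [T]
    have hTq : T (.q (n + 1)) = z .ξ₁ (.q n) := by simp [T]
    have hTr : T (.r (n + 1)) = z .ξ₂ (.r n) := by simp [T]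
    have hTs : T (.s (n + 1)) = z .ξ₂ (.s n) := by simp [T]
    have hT : ∀ χ ∈ T.support, level χ = n + 2 := by
      intro χ hχ
      by_contra hne
      refine Finsupp.mem_support_iff.1 hχ ?_
      have h1 : χ ≠ .p (n + 1) := by rintro rfl; exact hne rfl
      have h2 : χ ≠ .q (n + 1) := by rintro rfl; exact hne rfl
      have h3 : χ ≠ .r (n + 1) := by rintro rfl; exact hne rfl
      have h4 : χ ≠ .s (n + 1) := by rintro rfl; exact hne rfl
      simp [T, h1, h2, h3, h4]
    refine ⟨T, ⟨hT, ?_⟩, ?_⟩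
    · intro γ k hγ hk
      obtain ⟨e1, e2, e3, e4⟩ := ev T (supp T hT) k hk
      obtain ⟨s1, s2, s3, s4⟩ := sol k hk
      cases γ with
      | p m => obtain rfl : m = n := by simpa [level] using hγ
               rw [e1, s1, hTp]
      | q m => obtain rfl : m = n := by simpa [level] using hγ
               rw [e3, s3, hTp, hTq]
      | r m => obtain rfl : m = n := by simpa [level] using hγ
               rw [e2, s2, hTr]
      | s m => obtain rfl : m = n := by simpa [level] using hγ
               rw [e4, s4, hTr, hTs]
      | η₁ =>
        have h0 : ∀ i, level i = 0 → T i = 0 := fun i hi => supp T hT i (by omega)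
        rw [hη k hk]
        simp [dMC, wedge_apply, form_apply, h0 .σ₁₃ rfl, h0 .ξ₂ rfl, h0 .ξ₁ rfl]
      | _ => simp [level] at hγ
    · rintro T' ⟨hT', h⟩
      have l0 : level .ξ₁ ≤ n := Nat.zero_le _
      have l0' : level .ξ₂ ≤ n := Nat.zero_le _
      obtain ⟨e1, -, e3, -⟩ := ev T' (supp T' hT') _ l0
      obtain ⟨-, e2, -, e4⟩ := ev T' (supp T' hT') _ l0'
      rw [← h _ _ rfl l0] at e1 e3
      rw [← h _ _ rfl l0'] at e2 e4
      have s11 : ξ₁ (Finsupp.single .ξ₁ 1) = 1 := by simp [form]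
      have s22 : ξ₂ (Finsupp.single .ξ₂ 1) = 1 := by simp [form]
      have s31 : ξ₃ (Finsupp.single .ξ₁ 1) = 0 := by simp [form]
      have s32 : ξ₃ (Finsupp.single .ξ₂ 1) = 0 := by simp [form]
      rw [s11] at e1; rw [s22] at e2; rw [s11, s31] at e3; rw [s22, s32] at e4
      ext i
      by_cases hi : level i = n + 2
      · cases i with
        | p m => obtain rfl : m = n + 1 := by simpa [level] using hi
                 rw [hTp, e1, mul_one]
        | q m => obtain rfl : m = n + 1 := by simpa [level] using hi
                 rw [hTq]; linarith
        | r m => obtain rfl : m = n + 1 := by simpa [level] using hi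
                 rw [hTr, e2, mul_one]
        | s m => obtain rfl : m = n + 1 := by simpa [level] using hi
                 rw [hTs]; linarith
        | _ => simp [level] at hi
      · rw [supp T hT i hi, supp T' hT' i hi]

/-! #### The exterior ideal and the cocycles -/

/-- The generators of the exterior ideal `I`. -/
def idealGenerators : Set (𝔤₂ →ₗ[ℝ] ℝ) :=
  {θ₀, θ₁, θ₂, θ₃, ξ₁, ξ₂, ξ₃, σ₁₁, σ₁₃, σ₂₂, σ₂₃, σ₃₃, η₁, η₂, η₃, η₄, η₅}

/-- The degree-`2` component of the exterior ideal `I`. -/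
def I₂ : Submodule ℝ (LieModule.Cohomology.twoCochain ℝ 𝔤₂ ℝ) :=
  exteriorIdeal₂ ℝ 𝔤₂ idealGenerators

/-- `Ω₁ = η₁ ∧ (ξ₁ + ξ₂ + ξ₃) - (θ₁ + ξ₂) ∧ ξ₁ + (θ₃ + ξ₃) ∧ ξ₂`. -/
def Ω₁ : LieModule.Cohomology.twoCochain ℝ 𝔤₂ ℝ :=
  wedgeCochain ℝ 𝔤₂ η₁ (ξ₁ + ξ₂ + ξ₃) - wedgeCochain ℝ 𝔤₂ (θ₁ + ξ₂) ξ₁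
    + wedgeCochain ℝ 𝔤₂ (θ₃ + ξ₃) ξ₂

/-- `Ω₂ = (σ₃₃ - θ₃) ∧ ξ₃`. -/
def Ω₂ : LieModule.Cohomology.twoCochain ℝ 𝔤₂ ℝ :=
  wedgeCochain ℝ 𝔤₂ (σ₃₃ - θ₃) ξ₃

end BoyerFinley

end

set_option maxSynthPendingDepth 4

noncomputable section

set_option linter.unusedSimpArgs false
set_option linter.unusedTactic false
set_option linter.unreachableTactic false

namespace BoyerFinley

open LieModule.Cohomology

/-! ### The basis dual to the forms `a n`, `b n`, `α n`, `β n`, `ζ`, `ξ₃`, `θ₀` -/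

/-! The forms split $\mathfrak g_2$ into familiar pieces. Through exponential generating series,
$a_n$ and $b_n$ are the Taylor coefficients of two commuting copies of polynomial vector fields
$u\,\partial_t$ on a line, and $\alpha_n$, $\beta_n$ those of modules on which $u$ acts by
$v\mapsto(uv)'$. The remaining directions are dual to $\zeta$, $\xi^3$ and $\theta_0$.

The sum `euler` of the two fields $t\,\partial_t$ acts on the vectors dual to $a_n,b_n$ with weight
$n-1$ and on those dual to $\alpha_n,\beta_n$ with weight $n+1$. The other three directions have
generalized weight zero, with one Jordan block, $\mathrm{vξ}\mapsto 2\,\mathrm{vθ}$. Since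
$\zeta(\mathrm{euler})=0$, Cartan's formula $d_{c\zeta}\,i_E+i_E\,d_{c\zeta}=L_E$ holds for the
deformed differential too, so only weight zero contributes to cohomology. This is
`exists_weight_zero` (a primitive built from an inverse of $\mathrm{ad}\,E$ makes $i_E\Omega$ vanish
on nonzero weights), `apply_eq_zero_of_weight` and `apply_vξ_eq_zero`.

In weight zero the problem is finite: $\Omega$ is determined by its values on pairs of weights
$(-1,1)$ and $(0,0)$. The cocycle identities (`cocycle_relations`) leave five numbers: the values at
$(a_0,a_2)$, $(b_0,b_2)$, $(a_0,\alpha_0)$, $(b_0,\beta_0)$, $(\zeta,\xi^3)$, naming vectors by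
their dual forms. They also show that if the values at $(a_0,a_2)$, $(b_0,b_2)$ and $(b_0,\beta_0)$
vanish, then $(1+c)\,\Omega(a_0,\alpha_0)=0$. By `coboundary_values` a coboundary $d_{c\zeta}\eta$
takes at these five places the values $-\eta(a_1)$, $-\eta(b_1)$, $\eta(\theta_0)$,
$\eta(\theta_0)$, $(1+c)\eta(\xi^3)+2\eta(\theta_0)$. For $c\ne-1$ everything can be removed. For
$c=-1$ two invariants survive, $\Omega(a_0,\alpha_0)-\Omega(b_0,\beta_0)$ and
$\Omega(\zeta,\xi^3)-2\,\Omega(b_0,\beta_0)$; they equal $(1,1)$ on the weight-zero part of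
$\Omega_1$ and $(0,1)$ on $\Omega_2$.

The argument computes the whole of $H^2_{c\zeta}$; the ideal $I$ enters only because $\Omega_1$ and
$\Omega_2$ lie in it. -/

/-- The basis vector of `𝔤₂` with label `i`. -/
def e (i : MC) : 𝔤₂ := Finsupp.single i 1

open Classical in
theorem form_e (i j : MC) : form i (e j) = if j = i then 1 else 0 := by
  simp [form, e, Finsupp.single_apply]

/-- The vector dual to `a 0`. -/
def va0 : 𝔤₂ := e .ξ₁ - e .θ₂ - e .σ₂₃
/-- The vector dual to `b 0`. -/
def vb0 : 𝔤₂ := e .ξ₂ - e .θ₁ - e .σ₁₃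
/-- The vector dual to `a 1`. -/
def va1 : 𝔤₂ := e .σ₃₃ + e .θ₃ - e .η₁
/-- The vector dual to `b 1`. -/
def vb1 : 𝔤₂ := e .σ₃₃ + e .θ₃
/-- The vector dual to `a 2`. -/
def va2 : 𝔤₂ := -e .σ₁₃
/-- The vector dual to `b 2`. -/
def vb2 : 𝔤₂ := -e .σ₂₃
/-- The vector dual to `α 0`. -/
def vα0 : 𝔤₂ := e .θ₁
/-- The vector dual to `β 0`. -/
def vβ0 : 𝔤₂ := e .θ₂
/-- The vector dual to `ζ`. -/
def vζ : 𝔤₂ := e .η₁ - e .σ₃₃ - (2 : ℝ) • e .θ₃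
/-- The vector dual to `ξ₃`. -/
def vξ : 𝔤₂ := e .ξ₃ - e .σ₃₃ - e .θ₃
/-- The vector dual to `θ₀`. -/
def vθ : 𝔤₂ := e .θ₀

/-- The Euler vector field, the sum of the vectors dual to `a 1` and `b 1`. -/
def euler : 𝔤₂ := va1 + vb1

theorem lie_eq_br (X Y : 𝔤₂) : ⁅X, Y⁆ = br X Y := rfl

theorem ext_form {X Y : 𝔤₂} (h : ∀ i, form i X = form i Y) : X = Y := Finsupp.ext h

/-! ### Brackets of the dual vectors of low order. -/

/-- The indices in each term add up to $n+4$. With both at most $2$ the only possible term is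
$u_2\wedge u_2=0$; this is closure of
$\mathfrak{sl}_2=\langle\partial_t,t\partial_t,t^2\partial_t\rangle$. -/
theorem quadA_add_three {u : ℕ → (𝔤₂ →ₗ[ℝ] ℝ)} {X Y : 𝔤₂} (hX : ∀ n, u (n + 3) X = 0)
    (hY : ∀ n, u (n + 3) Y = 0) (n : ℕ) : quadA u (n + 3) X Y = 0 := by
  have hX' : ∀ m, 3 ≤ m → u m X = 0 := fun m hm => by
    obtain ⟨k, rfl⟩ := Nat.exists_eq_add_of_le' hm; exact hX k
  have hY' : ∀ m, 3 ≤ m → u m Y = 0 := fun m hm => by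
    obtain ⟨k, rfl⟩ := Nat.exists_eq_add_of_le' hm; exact hY k
  rw [quadA_apply]
  refine Finset.sum_eq_zero fun k hk => ?_
  have hk' := Finset.mem_range.1 hk
  by_cases h1 : 3 ≤ k + 1
  · simp [hX' _ h1, hY' _ h1]
  by_cases h2 : 3 ≤ n + 3 - k
  · simp [hX' _ h2, hY' _ h2]
  obtain rfl : k = 1 := by omega
  obtain rfl : n = 0 := by omega
  simp [mul_comm]

/-- Only $v_0$ survives among the $v$'s, and in the sum it is paired with $u_{n+3}$, which vanishes.
-/
theorem quadB_add_two {u v : ℕ → (𝔤₂ →ₗ[ℝ] ℝ)} {X Y : 𝔤₂} (hX : ∀ n, u (n + 3) X = 0)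
    (hY : ∀ n, u (n + 3) Y = 0) (hX' : ∀ n, v (n + 1) X = 0) (hY' : ∀ n, v (n + 1) Y = 0)
    (n : ℕ) : quadB u v (n + 2) X Y = 0 := by
  rw [quadB_apply, Finset.sum_eq_zero]
  · simp [hX', hY', show n + 2 + 2 = (n + 1) + 3 by ring, hX (n + 1), hY (n + 1)]
  · intro k hk
    have hk' := Finset.mem_range.1 hk
    obtain ⟨m, hm⟩ : ∃ m, m = n + 2 + 1 - k := ⟨_, rfl⟩
    rw [← hm]
    cases m with
    | succ m => simp [hX', hY']
    | zero =>
      obtain rfl : k = n + 3 := by omega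
      simp [hX, hY]

/-- The span of the vectors dual to the forms of low order. -/
def lowSpace : Submodule ℝ 𝔤₂ where
  carrier := {X | (∀ n, form (.p n) X = 0 ∧ form (.q n) X = 0 ∧ form (.r n) X = 0 ∧
    form (.s n) X = 0) ∧ form .σ₁₁ X = 0 ∧ form .σ₂₂ X = 0}
  add_mem' hX hY := ⟨fun n => by simp [(hX.1 n), (hY.1 n)], by simp [hX.2, hY.2],
    by simp [hX.2, hY.2]⟩
  zero_mem' := by simp
  smul_mem' c X hX := ⟨fun n => by simp [(hX.1 n)], by simp [hX.2], by simp [hX.2]⟩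

theorem low_vectors : va0 ∈ lowSpace ∧ vb0 ∈ lowSpace ∧ va1 ∈ lowSpace ∧ vb1 ∈ lowSpace ∧
    va2 ∈ lowSpace ∧ vb2 ∈ lowSpace ∧ vα0 ∈ lowSpace ∧ vβ0 ∈ lowSpace ∧ vζ ∈ lowSpace ∧
    vξ ∈ lowSpace ∧ vθ ∈ lowSpace := by
  refine ⟨?_, ?_, ?_, ?_, ?_, ?_, ?_, ?_, ?_, ?_, ?_⟩ <;>
  · refine ⟨fun n => ⟨?_, ?_, ?_, ?_⟩, ?_, ?_⟩ <;>
      simp only [va0, vb0, va1, vb1, va2, vb2, vα0, vβ0, vζ, vξ, vθ, map_add, map_sub, map_neg,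
        map_smul, form_e, reduceCtorEq, if_false, smul_zero, add_zero, sub_zero, neg_zero]

/-- Only the components of low order of the bracket of the vectors dual to the forms of low order
are nonzero. -/
theorem lie_eq_of_low {X Y Z : 𝔤₂} (hX : X ∈ lowSpace) (hY : Y ∈ lowSpace) (hZ : Z ∈ lowSpace)
    (h : -dMC .θ₀ X Y = form .θ₀ Z ∧ -dMC .θ₁ X Y = form .θ₁ Z ∧ -dMC .θ₂ X Y = form .θ₂ Z ∧
      -dMC .θ₃ X Y = form .θ₃ Z ∧ -dMC .ξ₁ X Y = form .ξ₁ Z ∧ -dMC .ξ₂ X Y = form .ξ₂ Z ∧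
      -dMC .ξ₃ X Y = form .ξ₃ Z ∧ -dMC .σ₁₁ X Y = form .σ₁₁ Z ∧ -dMC .σ₁₃ X Y = form .σ₁₃ Z ∧
      -dMC .σ₂₂ X Y = form .σ₂₂ Z ∧ -dMC .σ₂₃ X Y = form .σ₂₃ Z ∧ -dMC .σ₃₃ X Y = form .σ₃₃ Z ∧
      -dMC .η₁ X Y = form .η₁ Z) :
    ⁅X, Y⁆ = Z := by
  have ha : ∀ X ∈ lowSpace, ∀ n, a (n + 3) X = 0 := fun X hX n => by simp [a, (hX.1 n).1]
  have hb : ∀ X ∈ lowSpace, ∀ n, b (n + 3) X = 0 := fun X hX n => by simp [b, (hX.1 n).2.2.1]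
  have hα : ∀ X ∈ lowSpace, ∀ n, α (n + 1) X = 0 := fun X hX n => by
    cases n <;> simp [α, (hX.1 _).2.1, hX.2.1]
  have hβ : ∀ X ∈ lowSpace, ∀ n, β (n + 1) X = 0 := fun X hX n => by
    cases n <;> simp [β, (hX.1 _).2.2.2, hX.2.2]
  obtain ⟨h1, h2, h3, h4, h5, h6, h7, h8, h9, h10, h11, h12, h13⟩ := h
  refine ext_form fun i => ?_
  rw [form_lie]
  cases i with
  | p n => simp [dMC_p, quadA_add_three (ha X hX) (ha Y hY), (hZ.1 n).1]
  | q n =>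
    simp [dMC_q, quadB_add_two (ha X hX) (ha Y hY) (hα X hX) (hα Y hY), (hZ.1 n).2.1]
  | r n => simp [dMC_r, quadA_add_three (hb X hX) (hb Y hY), (hZ.1 n).2.2.1]
  | s n =>
    simp [dMC_s, quadB_add_two (hb X hX) (hb Y hY) (hβ X hX) (hβ Y hY), (hZ.1 n).2.2.2]
  | _ => assumption

/-- Here begins a partial multiplication table, limited to the brackets needed for the identities
between the weight-zero components and for closed 1-forms. In the vector field picture
$\mathrm{va}_n$ is $\frac{t^n}{n!}\partial_t$. -/
theorem lie_a0 : ⁅va0, va2⁆ = va1 ∧ ⁅va0, vb1⁆ = 0 ∧ ⁅va0, vζ⁆ = 0 ∧ ⁅va0, vξ⁆ = 0 ∧ ⁅va0, vθ⁆ = 0 ∧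
    ⁅va0, vα0⁆ = -vθ ∧ ⁅va0, vb2⁆ = 0 ∧ ⁅va0, vβ0⁆ = 0 := by
  obtain ⟨ma0, mb0, ma1, mb1, ma2, mb2, mα0, mβ0, mζ, mξ, mθ⟩ := low_vectors
  refine ⟨?_, ?_, ?_, ?_, ?_, ?_, ?_, ?_⟩ <;>
  · refine lie_eq_of_low (by assumption) (by assumption) ?_ ?_
    · first
        | assumption
        | exact zero_mem _
        | exact neg_mem (by assumption)
        | exact Submodule.smul_mem _ _ (by assumption)
    · simp only [dMC, wedge_apply, LinearMap.add_apply, LinearMap.sub_apply,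
        LinearMap.smul_apply, smul_eq_mul]
      simp only [va0, vb0, va1, vb1, va2, vb2, vα0, vβ0, vζ, vξ, vθ, map_add, map_sub,
        map_neg, map_smul, map_zero, form_e, reduceCtorEq, if_false, if_true, smul_eq_mul]
      norm_num

theorem lie_b0 : ⁅vb0, vb2⁆ = vb1 ∧ ⁅vb0, va1⁆ = 0 ∧ ⁅vb0, vζ⁆ = 0 ∧ ⁅vb0, vξ⁆ = 0 ∧ ⁅vb0, vθ⁆ = 0 ∧
    ⁅vb0, vβ0⁆ = -vθ ∧ ⁅vb0, va2⁆ = 0 ∧ ⁅vb0, vα0⁆ = 0 := by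
  obtain ⟨ma0, mb0, ma1, mb1, ma2, mb2, mα0, mβ0, mζ, mξ, mθ⟩ := low_vectors
  refine ⟨?_, ?_, ?_, ?_, ?_, ?_, ?_, ?_⟩ <;>
  · refine lie_eq_of_low (by assumption) (by assumption) ?_ ?_
    · first
        | assumption
        | exact zero_mem _
        | exact neg_mem (by assumption)
        | exact Submodule.smul_mem _ _ (by assumption)
    · simp only [dMC, wedge_apply, LinearMap.add_apply, LinearMap.sub_apply,
        LinearMap.smul_apply, smul_eq_mul]
      simp only [va0, vb0, va1, vb1, va2, vb2, vα0, vβ0, vζ, vξ, vθ, map_add, map_sub,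
        map_neg, map_smul, map_zero, form_e, reduceCtorEq, if_false, if_true, smul_eq_mul]
      norm_num

theorem lie_a1 : ⁅va1, va0⁆ = -va0 ∧ ⁅va1, vb2⁆ = 0 ∧ ⁅va1, vβ0⁆ = 0 := by
  obtain ⟨ma0, mb0, ma1, mb1, ma2, mb2, mα0, mβ0, mζ, mξ, mθ⟩ := low_vectors
  refine ⟨?_, ?_, ?_⟩ <;>
  · refine lie_eq_of_low (by assumption) (by assumption) ?_ ?_
    · first
        | assumption
        | exact zero_mem _
        | exact neg_mem (by assumption)
        | exact Submodule.smul_mem _ _ (by assumption)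
    · simp only [dMC, wedge_apply, LinearMap.add_apply, LinearMap.sub_apply,
        LinearMap.smul_apply, smul_eq_mul]
      simp only [va0, vb0, va1, vb1, va2, vb2, vα0, vβ0, vζ, vξ, vθ, map_add, map_sub,
        map_neg, map_smul, map_zero, form_e, reduceCtorEq, if_false, if_true, smul_eq_mul]
      norm_num

theorem lie_b1 : ⁅vb1, vb0⁆ = -vb0 ∧ ⁅vb1, va2⁆ = 0 ∧ ⁅vb1, vα0⁆ = 0 := by
  obtain ⟨ma0, mb0, ma1, mb1, ma2, mb2, mα0, mβ0, mζ, mξ, mθ⟩ := low_vectors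
  refine ⟨?_, ?_, ?_⟩ <;>
  · refine lie_eq_of_low (by assumption) (by assumption) ?_ ?_
    · first
        | assumption
        | exact zero_mem _
        | exact neg_mem (by assumption)
        | exact Submodule.smul_mem _ _ (by assumption)
    · simp only [dMC, wedge_apply, LinearMap.add_apply, LinearMap.sub_apply,
        LinearMap.smul_apply, smul_eq_mul]
      simp only [va0, vb0, va1, vb1, va2, vb2, vα0, vβ0, vζ, vξ, vθ, map_add, map_sub,
        map_neg, map_smul, map_zero, form_e, reduceCtorEq, if_false, if_true, smul_eq_mul]
      norm_num

theorem lie_a2 : ⁅va2, vb1⁆ = 0 ∧ ⁅va2, vζ⁆ = 0 ∧ ⁅va2, vξ⁆ = -vα0 ∧ ⁅va2, vθ⁆ = 0 := by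
  obtain ⟨ma0, mb0, ma1, mb1, ma2, mb2, mα0, mβ0, mζ, mξ, mθ⟩ := low_vectors
  refine ⟨?_, ?_, ?_, ?_⟩ <;>
  · refine lie_eq_of_low (by assumption) (by assumption) ?_ ?_
    · first
        | assumption
        | exact zero_mem _
        | exact neg_mem (by assumption)
        | exact Submodule.smul_mem _ _ (by assumption)
    · simp only [dMC, wedge_apply, LinearMap.add_apply, LinearMap.sub_apply,
        LinearMap.smul_apply, smul_eq_mul]
      simp only [va0, vb0, va1, vb1, va2, vb2, vα0, vβ0, vζ, vξ, vθ, map_add, map_sub,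
        map_neg, map_smul, map_zero, form_e, reduceCtorEq, if_false, if_true, smul_eq_mul]
      norm_num

theorem lie_b2 : ⁅vb2, va1⁆ = 0 ∧ ⁅vb2, vζ⁆ = 0 ∧ ⁅vb2, vξ⁆ = -vβ0 ∧ ⁅vb2, vθ⁆ = 0 := by
  obtain ⟨ma0, mb0, ma1, mb1, ma2, mb2, mα0, mβ0, mζ, mξ, mθ⟩ := low_vectors
  refine ⟨?_, ?_, ?_, ?_⟩ <;>
  · refine lie_eq_of_low (by assumption) (by assumption) ?_ ?_
    · first
        | assumption
        | exact zero_mem _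
        | exact neg_mem (by assumption)
        | exact Submodule.smul_mem _ _ (by assumption)
    · simp only [dMC, wedge_apply, LinearMap.add_apply, LinearMap.sub_apply,
        LinearMap.smul_apply, smul_eq_mul]
      simp only [va0, vb0, va1, vb1, va2, vb2, vα0, vβ0, vζ, vξ, vθ, map_add, map_sub,
        map_neg, map_smul, map_zero, form_e, reduceCtorEq, if_false, if_true, smul_eq_mul]
      norm_num

theorem lie_α0 : ⁅vα0, vζ⁆ = vα0 ∧ ⁅vα0, vξ⁆ = 0 ∧ ⁅vβ0, vζ⁆ = vβ0 ∧
    ⁅vζ, vξ⁆ = -vξ - (2 : ℝ) • vθ := by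
  obtain ⟨ma0, mb0, ma1, mb1, ma2, mb2, mα0, mβ0, mζ, mξ, mθ⟩ := low_vectors
  refine ⟨?_, ?_, ?_, ?_⟩ <;>
  · refine lie_eq_of_low (by assumption) (by assumption) ?_ ?_
    · first
        | assumption
        | exact zero_mem _
        | exact sub_mem (neg_mem mξ) (Submodule.smul_mem _ _ mθ)
        | exact neg_mem (by assumption)
        | exact Submodule.smul_mem _ _ (by assumption)
    · simp only [dMC, wedge_apply, LinearMap.add_apply, LinearMap.sub_apply,
        LinearMap.smul_apply, smul_eq_mul]
      simp only [va0, vb0, va1, vb1, va2, vb2, vα0, vβ0, vζ, vξ, vθ, map_add, map_sub,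
        map_neg, map_smul, map_zero, form_e, reduceCtorEq, if_false, if_true, smul_eq_mul]
      norm_num

/-- Zero weights are also written as multiples, so that each entry serves as an eigenvector
hypothesis. Only `vξ` is not an eigenvector. -/
theorem lie_euler : ⁅euler, va0⁆ = (-1 : ℝ) • va0 ∧ ⁅euler, vb0⁆ = (-1 : ℝ) • vb0 ∧
    ⁅euler, va1⁆ = (0 : ℝ) • va1 ∧ ⁅euler, vb1⁆ = (0 : ℝ) • vb1 ∧ ⁅euler, vζ⁆ = (0 : ℝ) • vζ ∧
    ⁅euler, vθ⁆ = (0 : ℝ) • vθ ∧ ⁅euler, vξ⁆ = (2 : ℝ) • vθ := by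
  obtain ⟨ma0, mb0, ma1, mb1, ma2, mb2, mα0, mβ0, mζ, mξ, mθ⟩ := low_vectors
  have mE : euler ∈ lowSpace := add_mem ma1 mb1
  refine ⟨?_, ?_, ?_, ?_, ?_, ?_, ?_⟩ <;>
  · refine lie_eq_of_low (by assumption) (by assumption) ?_ ?_
    · first
        | assumption
        | exact zero_mem _
        | exact neg_mem (by assumption)
        | exact Submodule.smul_mem _ _ (by assumption)
    · simp only [dMC, wedge_apply, LinearMap.add_apply, LinearMap.sub_apply,
        LinearMap.smul_apply, smul_eq_mul]
      simp only [euler, va0, vb0, va1, vb1, va2, vb2, vα0, vβ0, vζ, vξ, vθ, map_add, map_sub,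
        map_neg, map_smul, map_zero, form_e, reduceCtorEq, if_false, if_true, smul_eq_mul]
      norm_num

/-! ### The weights of the Euler vector field -/

theorem form_euler : ζ euler = 0 ∧ ξ₃ euler = 0 ∧ θ₀ euler = 0 ∧ a 1 euler = 1 ∧ b 1 euler = 1 := by
  simp [euler, va1, vb1, ζ, a, b, form_e]

theorem a_euler {n : ℕ} (hn : n ≠ 1) : a n euler = 0 := by
  match n with
  | 0 => simp [euler, va1, vb1, a, form_e]
  | 1 => exact absurd rfl hn
  | 2 => simp [euler, va1, vb1, a, form_e]
  | n + 3 => simp [euler, va1, vb1, a, form_e]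

theorem b_euler {n : ℕ} (hn : n ≠ 1) : b n euler = 0 := by
  match n with
  | 0 => simp [euler, va1, vb1, b, form_e]
  | 1 => exact absurd rfl hn
  | 2 => simp [euler, va1, vb1, b, form_e]
  | n + 3 => simp [euler, va1, vb1, b, form_e]

theorem α_euler (n : ℕ) : α n euler = 0 := by
  match n with
  | 0 => simp [euler, va1, vb1, α, form_e]
  | 1 => simp [euler, va1, vb1, α, form_e]
  | n + 2 => simp [euler, va1, vb1, α, form_e]

theorem β_euler (n : ℕ) : β n euler = 0 := by
  match n with
  | 0 => simp [euler, va1, vb1, β, form_e]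
  | 1 => simp [euler, va1, vb1, β, form_e]
  | n + 2 => simp [euler, va1, vb1, β, form_e]

/-- Since `E` is seen only by $u_1$, two contributions remain: $k=0$ gives $1$ and $k=n-1$ gives
$-n$. This is $[t\partial_t,t^n\partial_t]=(n-1)t^n\partial_t$. -/
theorem quadA_euler {u : ℕ → (𝔤₂ →ₗ[ℝ] ℝ)} {E : 𝔤₂} (h1 : u 1 E = 1)
    (h : ∀ n, n ≠ 1 → u n E = 0) (n : ℕ) (X : 𝔤₂) :
    quadA u n E X = -(((n : ℝ) - 1) * u n X) := by
  rw [quadA_apply]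
  simp only [mul_sub, Finset.sum_sub_distrib]
  rw [Finset.sum_eq_single 0]
  · match n with
    | 0 => simp [h1, h]
    | n + 1 =>
      rw [Finset.sum_eq_single n]
      · simp [h1]; ring
      · intro k hk hkn
        have := Finset.mem_range.1 hk
        rw [h (n + 1 - k) (by omega)]; simp
      · intro hn; exact absurd (Finset.mem_range.2 (by omega)) hn
  · intro k _ hk
    rw [h (k + 1) (by omega)]; simp
  · simp

/-- Only $k=1$ pairs `E` with a nonzero form, and its coefficient is $\binom{n+1}{1}$. -/
theorem quadB_euler {u v : ℕ → (𝔤₂ →ₗ[ℝ] ℝ)} {E : 𝔤₂} (h1 : u 1 E = 1)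
    (h : ∀ n, n ≠ 1 → u n E = 0) (hv : ∀ n, v n E = 0) (hζ : ζ E = 0) (hξ : ξ₃ E = 0)
    (n : ℕ) (X : 𝔤₂) : quadB u v n E X = -(((n : ℝ) + 1) * v n X) := by
  rw [quadB_apply, Finset.sum_eq_single 1]
  · simp [h1, hv, hζ, hξ, h (n + 2) (by omega)]
  · intro k _ hk
    rw [h k hk, hv]; simp
  · simp

theorem a_lie_euler (n : ℕ) (X : 𝔤₂) : a n ⁅euler, X⁆ = ((n : ℝ) - 1) * a n X := by
  rw [lie_eq_br, a_br, quadA_euler form_euler.2.2.2.1 fun _ => a_euler, neg_neg]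

theorem b_lie_euler (n : ℕ) (X : 𝔤₂) : b n ⁅euler, X⁆ = ((n : ℝ) - 1) * b n X := by
  rw [lie_eq_br, b_br, quadA_euler form_euler.2.2.2.2 fun _ => b_euler, neg_neg]

theorem α_lie_euler (n : ℕ) (X : 𝔤₂) : α n ⁅euler, X⁆ = ((n : ℝ) + 1) * α n X := by
  rw [lie_eq_br, α_br, quadB_euler form_euler.2.2.2.1 (fun _ => a_euler) α_euler form_euler.1
    form_euler.2.1, neg_neg]

theorem β_lie_euler (n : ℕ) (X : 𝔤₂) : β n ⁅euler, X⁆ = ((n : ℝ) + 1) * β n X := by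
  rw [lie_eq_br, β_br, quadB_euler form_euler.2.2.2.2 (fun _ => b_euler) β_euler form_euler.1
    form_euler.2.1, neg_neg]

theorem ζ_lie (X Y : 𝔤₂) : ζ ⁅X, Y⁆ = 0 := ζ_br X Y

theorem ξ₃_lie_euler (X : 𝔤₂) : ξ₃ ⁅euler, X⁆ = 0 := by
  rw [lie_eq_br, ξ₃_br, form_euler.1, form_euler.2.1]; ring

/-- The factor is $a_1(E)+b_1(E)=2$. This is the Jordan block that keeps $\mathrm{ad}\,E$ from being
diagonalizable. -/
theorem θ₀_lie_euler (X : 𝔤₂) : θ₀ ⁅euler, X⁆ = 2 * ξ₃ X := by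
  obtain ⟨h1, h2, h3, h4, h5⟩ := form_euler
  rw [lie_eq_br, θ₀_br, h1, h2, h3, h4, h5, a_euler (by omega), b_euler (by omega), α_euler,
    β_euler]
  ring

/-- The common kernel of the forms of weight zero. -/
def nonzeroWeight : Submodule ℝ 𝔤₂ :=
  LinearMap.ker (a 1) ⊓ LinearMap.ker (b 1) ⊓ LinearMap.ker ζ ⊓ LinearMap.ker ξ₃ ⊓
    LinearMap.ker θ₀

theorem mem_nonzeroWeight {X : 𝔤₂} : X ∈ nonzeroWeight ↔
    a 1 X = 0 ∧ b 1 X = 0 ∧ ζ X = 0 ∧ ξ₃ X = 0 ∧ θ₀ X = 0 := by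
  simp [nonzeroWeight, and_assoc]

/-- Four of the forms vanish on `⁅euler, X⁆` outright, and $\theta_0$ gives $2\xi^3(X)$; so
$\xi^3(X)=0$ has to be obtained before $\theta_0(X)=0$. -/
theorem mem_nonzeroWeight_of_lie {X : 𝔤₂} {w : ℝ} (hw : w ≠ 0) (h : ⁅euler, X⁆ = w • X) :
    X ∈ nonzeroWeight := by
  have h1 := a_lie_euler 1 X
  have h2 := b_lie_euler 1 X
  have h3 := ζ_lie euler X
  have h4 := ξ₃_lie_euler X
  have h5 := θ₀_lie_euler X
  rw [h, map_smul, smul_eq_mul] at h1 h2 h3 h4 h5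
  have h4' : ξ₃ X = 0 := (mul_eq_zero.1 h4).resolve_left hw
  rw [h4', mul_zero] at h5
  simp only [Nat.cast_one, sub_self, zero_mul] at h1 h2
  exact mem_nonzeroWeight.2 ⟨(mul_eq_zero.1 h1).resolve_left hw,
    (mul_eq_zero.1 h2).resolve_left hw, (mul_eq_zero.1 h3).resolve_left hw, h4',
    (mul_eq_zero.1 h5).resolve_left hw⟩

theorem lie_euler_eq_smul {X : 𝔤₂} {w : ℝ} (ha : ∀ n : ℕ, a n X = 0 ∨ (n : ℝ) - 1 = w)
    (hb : ∀ n : ℕ, b n X = 0 ∨ (n : ℝ) - 1 = w) (hα : ∀ n : ℕ, α n X = 0 ∨ (n : ℝ) + 1 = w)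
    (hβ : ∀ n : ℕ, β n X = 0 ∨ (n : ℝ) + 1 = w) (hζ : ζ X = 0) (hξ : ξ₃ X = 0)
    (hθ : θ₀ X = 0) : ⁅euler, X⁆ = w • X := by
  refine ext_forms (fun n => ?_) (fun n => ?_) (fun n => ?_) (fun n => ?_) ?_ ?_ ?_
  · rw [a_lie_euler, map_smul, smul_eq_mul]; rcases ha n with h | h <;> rw [h]; simp
  · rw [b_lie_euler, map_smul, smul_eq_mul]; rcases hb n with h | h <;> rw [h]; simp
  · rw [α_lie_euler, map_smul, smul_eq_mul]; rcases hα n with h | h <;> rw [h]; simp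
  · rw [β_lie_euler, map_smul, smul_eq_mul]; rcases hβ n with h | h <;> rw [h]; simp
  · rw [ζ_lie, map_smul, hζ, smul_zero]
  · rw [ξ₃_lie_euler, map_smul, hξ, smul_zero]
  · rw [θ₀_lie_euler, map_smul, hξ, hθ, smul_zero, mul_zero]

/-- The eigenvectors of positive weight. -/
def posVectors : Set 𝔤₂ := {X | ∃ w : ℝ, 0 < w ∧ ⁅euler, X⁆ = w • X}

theorem e_mem_posVectors (i : MC) (w : ℝ) (hw : 0 < w)
    (ha : ∀ n : ℕ, a n (e i) = 0 ∨ (n : ℝ) - 1 = w)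
    (hb : ∀ n : ℕ, b n (e i) = 0 ∨ (n : ℝ) - 1 = w)
    (hα : ∀ n : ℕ, α n (e i) = 0 ∨ (n : ℝ) + 1 = w)
    (hβ : ∀ n : ℕ, β n (e i) = 0 ∨ (n : ℝ) + 1 = w) (hζ : ζ (e i) = 0) (hξ : ξ₃ (e i) = 0)
    (hθ : θ₀ (e i) = 0) : e i ∈ posVectors :=
  ⟨w, hw, lie_euler_eq_smul ha hb hα hβ hζ hξ hθ⟩

theorem e_series_mem_posVectors (n : ℕ) : e (.p n) ∈ posVectors ∧ e (.q n) ∈ posVectors ∧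
    e (.r n) ∈ posVectors ∧ e (.s n) ∈ posVectors := by
  -- The labels `.p n`, `.r n` belong to index $n+3$ of `a`, `b`, of weight $(n+3)-1$; `.q n`, `.s
  -- n` belong to index $n+2$ of `α`, `β`, of weight $(n+2)+1$.
  refine ⟨e_mem_posVectors _ (n + 2) (by positivity) ?_ ?_ ?_ ?_ ?_ ?_ ?_,
    e_mem_posVectors _ (n + 3) (by positivity) ?_ ?_ ?_ ?_ ?_ ?_ ?_,
    e_mem_posVectors _ (n + 2) (by positivity) ?_ ?_ ?_ ?_ ?_ ?_ ?_,
    e_mem_posVectors _ (n + 3) (by positivity) ?_ ?_ ?_ ?_ ?_ ?_ ?_⟩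
  all_goals first
    | (simp [form_e, ζ]; done)
    | (intro m
       match m with
       | 0 => left; simp [a, b, α, β, form_e]
       | 1 => left; simp [a, b, α, β, form_e]
       | 2 =>
         simp only [a, b, α, β, form_e, LinearMap.neg_apply,
           LinearMap.add_apply]
         rcases eq_or_ne n 0 with rfl | h
         · simp <;> norm_num
         · simp [h]
       | m + 3 =>
         simp only [a, b, α, β, form_e, LinearMap.neg_apply]
         first
           | (rcases eq_or_ne n m with rfl | h
              · right; push_cast; ring
              · left; simp [h])
           | (rcases eq_or_ne n (m + 1) with rfl | h
              · right; push_cast; ring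
              · left; simp [h])
           | (left; simp))

theorem e_low_mem_posVectors : e .θ₁ ∈ posVectors ∧ e .θ₂ ∈ posVectors ∧ e .σ₁₁ ∈ posVectors ∧
    e .σ₁₃ ∈ posVectors ∧ e .σ₂₂ ∈ posVectors ∧ e .σ₂₃ ∈ posVectors := by
  refine ⟨e_mem_posVectors _ 1 (by positivity) ?_ ?_ ?_ ?_ ?_ ?_ ?_,
    e_mem_posVectors _ 1 (by positivity) ?_ ?_ ?_ ?_ ?_ ?_ ?_,
    e_mem_posVectors _ 2 (by positivity) ?_ ?_ ?_ ?_ ?_ ?_ ?_,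
    e_mem_posVectors _ 1 (by positivity) ?_ ?_ ?_ ?_ ?_ ?_ ?_,
    e_mem_posVectors _ 2 (by positivity) ?_ ?_ ?_ ?_ ?_ ?_ ?_,
    e_mem_posVectors _ 1 (by positivity) ?_ ?_ ?_ ?_ ?_ ?_ ?_⟩
  all_goals first
    | (simp [form_e, ζ]; done)
    | (intro m
       match m with
       | 0 => simp [a, b, α, β, form_e]
       | 1 => simp [a, b, α, β, form_e]; try norm_num
       | 2 => simp [a, b, α, β, form_e]; try norm_num
       | m + 3 => simp [a, b, α, β, form_e])

/-- The vectors dual to `a 0`, `b 0` and to the forms of weight zero. -/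
def nonposVectors : Set 𝔤₂ := {va0, vb0, va1, vb1, vζ, vξ, vθ}

theorem span_eq_top : Submodule.span ℝ (nonposVectors ∪ posVectors) = ⊤ := by
  obtain ⟨p1, p2, p3, p4, p5, p6⟩ := e_low_mem_posVectors
  have hp : ∀ X ∈ posVectors, X ∈ Submodule.span ℝ (nonposVectors ∪ posVectors) := fun X hX =>
    Submodule.subset_span (.inr hX)
  have hn : ∀ X ∈ nonposVectors, X ∈ Submodule.span ℝ (nonposVectors ∪ posVectors) := fun X hX =>
    Submodule.subset_span (.inl hX)
  have na0 := hn va0 (by simp [nonposVectors])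
  have nb0 := hn vb0 (by simp [nonposVectors])
  have na1 := hn va1 (by simp [nonposVectors])
  have nb1 := hn vb1 (by simp [nonposVectors])
  have nζ := hn vζ (by simp [nonposVectors])
  have nξ := hn vξ (by simp [nonposVectors])
  have nθ := hn vθ (by simp [nonposVectors])
  have he : ∀ i, e i ∈ Submodule.span ℝ (nonposVectors ∪ posVectors) := fun i => by
    cases i with
    | p n => exact hp _ (e_series_mem_posVectors n).1
    | q n => exact hp _ (e_series_mem_posVectors n).2.1
    | r n => exact hp _ (e_series_mem_posVectors n).2.2.1
    | s n => exact hp _ (e_series_mem_posVectors n).2.2.2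
    | θ₀ => exact nθ
    | θ₁ => exact hp _ p1
    | θ₂ => exact hp _ p2
    | σ₁₁ => exact hp _ p3
    | σ₁₃ => exact hp _ p4
    | σ₂₂ => exact hp _ p5
    | σ₂₃ => exact hp _ p6
    | ξ₁ =>
      rw [show e .ξ₁ = va0 + e .θ₂ + e .σ₂₃ by rw [va0]; abel]
      exact add_mem (add_mem na0 (hp _ p2)) (hp _ p6)
    | ξ₂ =>
      rw [show e .ξ₂ = vb0 + e .θ₁ + e .σ₁₃ by rw [vb0]; abel]
      exact add_mem (add_mem nb0 (hp _ p1)) (hp _ p4)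
    | ξ₃ =>
      rw [show e .ξ₃ = vξ + vb1 by rw [vξ, vb1]; abel]
      exact add_mem nξ nb1
    | η₁ =>
      rw [show e .η₁ = vb1 - va1 by rw [va1, vb1]; abel]
      exact sub_mem nb1 na1
    | θ₃ =>
      rw [show e .θ₃ = -va1 - vζ by rw [va1, vζ, two_smul]; abel]
      exact sub_mem (neg_mem na1) nζ
    | σ₃₃ =>
      rw [show e .σ₃₃ = vb1 + va1 + vζ by rw [va1, vb1, vζ, two_smul]; abel]
      exact add_mem (add_mem nb1 na1) nζ
  rw [eq_top_iff]
  intro X _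
  induction X using Finsupp.induction_linear with
  | zero => exact zero_mem _
  | add X Y hX hY => exact add_mem (hX trivial) (hY trivial)
  | single i c =>
    rw [show (Finsupp.single i c : 𝔤₂) = c • e i by simp [e]]
    exact Submodule.smul_mem _ _ (he i)

/-- The values of the forms on the vectors dual to `a 2`, `b 2`, `α 0`, `β 0` determine a vector of
weight one. -/
theorem eq_of_weight_one {X : 𝔤₂} (h : ⁅euler, X⁆ = (1 : ℝ) • X) :
    X = a 2 X • va2 + b 2 X • vb2 + α 0 X • vα0 + β 0 X • vβ0 := by
  obtain ⟨-, -, hζ, hξ, hθ⟩ := mem_nonzeroWeight.1 (mem_nonzeroWeight_of_lie one_ne_zero h)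
  have ha : ∀ n, n ≠ 2 → a n X = 0 := fun n hn => by
    have := a_lie_euler n X
    rw [h, one_smul] at this
    have hn' : (n : ℝ) - 2 ≠ 0 := sub_ne_zero.2 (by exact_mod_cast hn)
    exact (mul_eq_zero.1 (show ((n : ℝ) - 2) * a n X = 0 by linarith)).resolve_left hn'
  have hb : ∀ n, n ≠ 2 → b n X = 0 := fun n hn => by
    have := b_lie_euler n X
    rw [h, one_smul] at this
    have hn' : (n : ℝ) - 2 ≠ 0 := sub_ne_zero.2 (by exact_mod_cast hn)
    exact (mul_eq_zero.1 (show ((n : ℝ) - 2) * b n X = 0 by linarith)).resolve_left hn'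
  have hα : ∀ n, n ≠ 0 → α n X = 0 := fun n hn => by
    have := α_lie_euler n X
    rw [h, one_smul] at this
    have hn' : (n : ℝ) ≠ 0 := by exact_mod_cast hn
    exact (mul_eq_zero.1 (show (n : ℝ) * α n X = 0 by linarith)).resolve_left hn'
  have hβ : ∀ n, n ≠ 0 → β n X = 0 := fun n hn => by
    have := β_lie_euler n X
    rw [h, one_smul] at this
    have hn' : (n : ℝ) ≠ 0 := by exact_mod_cast hn
    exact (mul_eq_zero.1 (show (n : ℝ) * β n X = 0 by linarith)).resolve_left hn'
  simp only [va2, vb2, vα0, vβ0]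
  refine ext_forms (fun n => ?_) (fun n => ?_) (fun n => ?_) (fun n => ?_) ?_ ?_ ?_
  · match n with
    | 0 => simp [ha 0 (by omega)]; simp [a, form_e]
    | 1 => simp [ha 1 (by omega)]; simp [a, form_e]
    | 2 => simp; simp [a, form_e]
    | n + 3 => simp [ha (n + 3) (by omega)]; simp [a, form_e]
  · match n with
    | 0 => simp [hb 0 (by omega)]; simp [b, form_e]
    | 1 => simp [hb 1 (by omega)]; simp [b, form_e]
    | 2 => simp; simp [b, form_e]
    | n + 3 => simp [hb (n + 3) (by omega)]; simp [b, form_e]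
  · match n with
    | 0 => simp; simp [α, form_e]
    | 1 => simp [hα 1 (by omega)]; simp [α, form_e]
    | n + 2 => simp [hα (n + 2) (by omega)]; simp [α, form_e]
  · match n with
    | 0 => simp; simp [β, form_e]
    | 1 => simp [hβ 1 (by omega)]; simp [β, form_e]
    | n + 2 => simp [hβ (n + 2) (by omega)]; simp [β, form_e]
  · rw [hζ]; simp [ζ, form_e]
  · rw [hξ]; simp [form_e]
  · rw [hθ]; simp [form_e]

/-- `ad euler` is injective on the vectors of nonzero weight. -/
theorem eq_zero_of_lie_euler {X : 𝔤₂} (hX : X ∈ nonzeroWeight) (h : ⁅euler, X⁆ = 0) : X = 0 := by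
  obtain ⟨ha1, hb1, hζ, hξ, hθ⟩ := mem_nonzeroWeight.1 hX
  refine ext_forms (fun n => ?_) (fun n => ?_) (fun n => ?_) (fun n => ?_) ?_ ?_ ?_
  · rw [map_zero]
    rcases eq_or_ne n 1 with rfl | hn
    · exact ha1
    have := a_lie_euler n X
    rw [h, map_zero, eq_comm, mul_eq_zero, sub_eq_zero] at this
    exact this.resolve_left (by exact_mod_cast hn)
  · rw [map_zero]
    rcases eq_or_ne n 1 with rfl | hn
    · exact hb1
    have := b_lie_euler n X
    rw [h, map_zero, eq_comm, mul_eq_zero, sub_eq_zero] at this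
    exact this.resolve_left (by exact_mod_cast hn)
  · have := α_lie_euler n X
    rw [h, map_zero, eq_comm, mul_eq_zero] at this
    rw [map_zero]
    exact this.resolve_left (by positivity)
  · have := β_lie_euler n X
    rw [h, map_zero, eq_comm, mul_eq_zero] at this
    rw [map_zero]
    exact this.resolve_left (by positivity)
  · rw [hζ, map_zero]
  · rw [hξ, map_zero]
  · rw [hθ, map_zero]

/-! ### Cocycles and coboundaries -/

variable {c : ℝ}

theorem deformedD₁₂_apply (η : oneCochain ℝ 𝔤₂ ℝ) (X Y : 𝔤₂) :
    deformedD₁₂ ℝ 𝔤₂ c ζ η X Y = -η ⁅X, Y⁆ + c * (ζ X * η Y - η X * ζ Y) := by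
  have h1 := d₁₂_apply_apply_ofTrivial (R := ℝ) (L := 𝔤₂) (M := ℝ) η X Y
  have h2 : wedgeLeft₁ ℝ 𝔤₂ ζ η X Y = ζ X * η Y - η X * ζ Y := wedge_apply ζ η X Y
  rw [← h1, ← h2]; rfl

theorem deformedD₂₃_apply (Ω : twoCochain ℝ 𝔤₂ ℝ) (X Y Z : 𝔤₂) :
    deformedD₂₃ ℝ 𝔤₂ c ζ Ω X Y Z = -Ω ⁅X, Y⁆ Z + Ω ⁅X, Z⁆ Y - Ω ⁅Y, Z⁆ X +
      c * (ζ X * Ω Y Z - ζ Y * Ω X Z + ζ Z * Ω X Y) := by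
  have h1 : d₂₃ ℝ 𝔤₂ ℝ Ω X Y Z = -Ω ⁅X, Y⁆ Z + Ω ⁅X, Z⁆ Y - Ω ⁅Y, Z⁆ X := by
    rw [d₂₃_apply, trivial_lie_zero, trivial_lie_zero, trivial_lie_zero]; ring
  rw [← h1]; rfl

theorem cocycle_eq {Ω : twoCochain ℝ 𝔤₂ ℝ} (h : deformedD₂₃ ℝ 𝔤₂ c ζ Ω = 0) (X Y Z : 𝔤₂) :
    -Ω ⁅X, Y⁆ Z + Ω ⁅X, Z⁆ Y - Ω ⁅Y, Z⁆ X + c * (ζ X * Ω Y Z - ζ Y * Ω X Z + ζ Z * Ω X Y) = 0 := by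
  rw [← deformedD₂₃_apply, h]; rfl

theorem d₁₂_ζ : d₁₂ ℝ 𝔤₂ ℝ ζ = 0 := by
  refine Subtype.ext (LinearMap.ext₂ fun X Y => ?_)
  change d₁₂ ℝ 𝔤₂ ℝ ζ X Y = 0
  rw [d₁₂_apply_apply_ofTrivial, ζ_lie, neg_zero]

/-- The values of `ζ` on the vectors dual to the forms of low order. -/
theorem ζ_values : ζ va0 = 0 ∧ ζ vb0 = 0 ∧ ζ va1 = 0 ∧ ζ vb1 = 0 ∧ ζ va2 = 0 ∧ ζ vb2 = 0 ∧
    ζ vα0 = 0 ∧ ζ vβ0 = 0 ∧ ζ vζ = 1 ∧ ζ vξ = 0 ∧ ζ vθ = 0 := by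
  simp [va0, vb0, va1, vb1, va2, vb2, vα0, vβ0, vζ, vξ, vθ, ζ, form_e]
  norm_num

/-! ### Reduction of cocycles to weight zero. -/

/-- A cocycle whose contraction with the Euler vector field is of weight zero is itself of weight
zero. -/
theorem apply_eq_zero_of_weight {Ω : twoCochain ℝ 𝔤₂ ℝ} (h : deformedD₂₃ ℝ 𝔤₂ c ζ Ω = 0)
    (hK : ∀ X ∈ nonzeroWeight, Ω euler X = 0) {Y Z : 𝔤₂} {y z : ℝ} (hY : ⁅euler, Y⁆ = y • Y)
    (hZ : ⁅euler, Z⁆ = z • Z) (hyz : y + z ≠ 0) : Ω Y Z = 0 := by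
  -- This identity is Cartan's formula evaluated on `Y`, `Z`; once the terms containing `euler` are
  -- shown to vanish it reads $(y+z)\,\Omega(Y,Z)=0$.
  have h1 := cocycle_eq h euler Y Z
  have h2 : ⁅Y, Z⁆ ∈ nonzeroWeight := by
    refine mem_nonzeroWeight_of_lie hyz ?_
    rw [leibniz_lie, hY, hZ, smul_lie, lie_smul, add_smul]
  have h3 : Ω ⁅Y, Z⁆ euler = 0 := by
    rw [← twoCochain_skew, hK _ h2, neg_zero]
  have h4 : ζ Y * Ω euler Z = 0 := by
    by_cases hy : y = 0
    · rw [hK Z (mem_nonzeroWeight_of_lie (by simpa [hy] using hyz) hZ), mul_zero]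
    · rw [(mem_nonzeroWeight.1 (mem_nonzeroWeight_of_lie hy hY)).2.2.1, zero_mul]
  have h5 : ζ Z * Ω euler Y = 0 := by
    by_cases hz : z = 0
    · rw [hK Y (mem_nonzeroWeight_of_lie (by simpa [hz] using hyz) hY), mul_zero]
    · rw [(mem_nonzeroWeight.1 (mem_nonzeroWeight_of_lie hz hZ)).2.2.1, zero_mul]
  have h6 : Ω (y • Y) Z = y * Ω Y Z := by rw [map_smul]; rfl
  have h7 : Ω (z • Z) Y = -(z * Ω Y Z) := by
    rw [map_smul, LinearMap.smul_apply, smul_eq_mul, ← twoCochain_skew]; ring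
  rw [hY, hZ, h6, h7, h3, h4, h5, form_euler.1] at h1
  exact (mul_eq_zero.1 (show (y + z) * Ω Y Z = 0 by linarith)).resolve_left hyz

/-- Since `vξ` is not an eigenvector, the weight of the bracket cannot be added up; the five
weight-zero components are computed directly instead, using that `vξ` is dual to $\xi^3$. -/
theorem vξ_lie_mem {Z : 𝔤₂} (hZ : Z ∈ nonzeroWeight) : ⁅vξ, Z⁆ ∈ nonzeroWeight := by
  obtain ⟨ha, hb, hζ, hξ, hθ⟩ := mem_nonzeroWeight.1 hZ
  have a0 : a 0 vξ = 0 := by simp [vξ, a, form_e]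
  have a1 : a 1 vξ = 0 := by simp [vξ, a, form_e]
  have a2 : a 2 vξ = 0 := by simp [vξ, a, form_e]
  have b0 : b 0 vξ = 0 := by simp [vξ, b, form_e]
  have b1 : b 1 vξ = 0 := by simp [vξ, b, form_e]
  have b2 : b 2 vξ = 0 := by simp [vξ, b, form_e]
  have α0 : α 0 vξ = 0 := by simp [vξ, α, form_e]
  have β0 : β 0 vξ = 0 := by simp [vξ, β, form_e]
  have ζ0 : ζ vξ = 0 := ζ_values.2.2.2.2.2.2.2.2.2.1
  refine mem_nonzeroWeight.2 ⟨?_, ?_, ζ_lie _ _, ?_, ?_⟩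
  · rw [lie_eq_br, a_br, quadA_apply]; simp [Finset.sum_range_succ, a0, a1, a2]
  · rw [lie_eq_br, b_br, quadA_apply]; simp [Finset.sum_range_succ, b0, b1, b2]
  · rw [lie_eq_br, ξ₃_br, ζ0, hζ]; ring
  · rw [lie_eq_br, θ₀_br, ha, hb, hζ, hξ, hθ, ζ0, a0, b0, α0, β0]; ring

/-- For the generalized eigenvector `vξ` Cartan's formula gives
$z\,\Omega(\mathrm{vξ},Z)+2\,\Omega(\mathrm{vθ},Z)=0$, and the second term vanishes because `vθ` is
a true eigenvector of weight zero. -/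
theorem apply_vξ_eq_zero {Ω : twoCochain ℝ 𝔤₂ ℝ} (h : deformedD₂₃ ℝ 𝔤₂ c ζ Ω = 0)
    (hK : ∀ X ∈ nonzeroWeight, Ω euler X = 0) {Z : 𝔤₂} {z : ℝ} (hZ : ⁅euler, Z⁆ = z • Z)
    (hz : z ≠ 0) : Ω vξ Z = 0 := by
  obtain ⟨-, -, -, -, -, eθ, eξ⟩ := lie_euler
  have hZ' := mem_nonzeroWeight_of_lie hz hZ
  have h1 := cocycle_eq h euler vξ Z
  have h2 : Ω vθ Z = 0 := apply_eq_zero_of_weight h hK eθ hZ (by simpa using hz)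
  have h3 : Ω ⁅vξ, Z⁆ euler = 0 := by
    rw [← twoCochain_skew, hK _ (vξ_lie_mem hZ'), neg_zero]
  have h6 : Ω ((2 : ℝ) • vθ) Z = 0 := by
    rw [map_smul, LinearMap.smul_apply, h2, smul_zero]
  have h7 : Ω (z • Z) vξ = -(z * Ω vξ Z) := by
    rw [map_smul, LinearMap.smul_apply, smul_eq_mul, ← twoCochain_skew]; ring
  rw [eξ, hZ, h6, h7, h3, form_euler.1, ζ_values.2.2.2.2.2.2.2.2.2.1,
    (mem_nonzeroWeight.1 hZ').2.2.1] at h1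
  exact (mul_eq_zero.1 (show z * Ω vξ Z = 0 by linarith)).resolve_left hz

/-- The relations between the components of weight zero of a cocycle. -/
theorem cocycle_relations {Ω : twoCochain ℝ 𝔤₂ ℝ} (h : deformedD₂₃ ℝ 𝔤₂ c ζ Ω = 0)
    (h₁ : Ω va0 va2 = 0) (h₂ : Ω vb0 vb2 = 0) (h₃ : Ω vb0 vβ0 = 0) :
    (Ω va0 vb2 = 0 ∧ Ω va0 vβ0 = 0 ∧ Ω vb0 va2 = 0 ∧ Ω vb0 vα0 = 0) ∧
    (Ω va1 vb1 = 0 ∧ Ω va1 vζ = 0 ∧ Ω va1 vξ = -Ω va0 vα0 ∧ Ω va1 vθ = 0) ∧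
    (Ω vb1 vζ = 0 ∧ Ω vb1 vξ = 0 ∧ Ω vb1 vθ = 0) ∧ Ω vζ vθ = 0 ∧ Ω vξ vθ = 0 ∧
    (1 + c) * Ω va0 vα0 = 0 := by
  obtain ⟨a02, a0b1, a0ζ, a0ξ, a0θ, a0α, a0b2, a0β⟩ := lie_a0
  obtain ⟨b02, b0a1, b0ζ, b0ξ, b0θ, b0β, b0a2, b0α⟩ := lie_b0
  obtain ⟨a1a0, a1b2, a1β⟩ := lie_a1
  obtain ⟨b1b0, b1a2, b1α⟩ := lie_b1
  obtain ⟨a2b1, a2ζ, a2ξ, a2θ⟩ := lie_a2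
  obtain ⟨b2a1, b2ζ, b2ξ, b2θ⟩ := lie_b2
  obtain ⟨αζ, αξ, βζ, -⟩ := lie_α0
  obtain ⟨ζ1, ζ2, ζ3, ζ4, ζ5, ζ6, ζ7, ζ8, ζ9, ζ10, ζ11⟩ := ζ_values
  have s : ∀ X Y, Ω Y X = -Ω X Y := fun X Y => (twoCochain_skew Ω X Y).symm
  have z : ∀ X, Ω 0 X = 0 := fun X => by rw [map_zero]; rfl
  have n : ∀ X Y, Ω (-X) Y = -Ω X Y := fun X Y => by rw [map_neg]; rfl
  -- The triples `e1`–`e4` isolate the mixed pairs of the two copies. In `e5`–`e11` the vectors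
  -- `va1`, `vb1` enter as `⁅va0, va2⁆`, `⁅vb0, vb2⁆`; in `e12`–`e14` the vector `vθ` enters as
  -- `-⁅va0, vα0⁆` or `-⁅vb0, vβ0⁆`.
  have e1 := cocycle_eq h va1 va0 vb2
  have e2 := cocycle_eq h va1 va0 vβ0
  have e3 := cocycle_eq h vb1 vb0 va2
  have e4 := cocycle_eq h vb1 vb0 vα0
  have e5 := cocycle_eq h va0 va2 vb1
  have e6 := cocycle_eq h va0 va2 vζ
  have e7 := cocycle_eq h va0 va2 vξ
  have e8 := cocycle_eq h va0 va2 vθ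
  have e9 := cocycle_eq h vb0 vb2 vζ
  have e10 := cocycle_eq h vb0 vb2 vξ
  have e11 := cocycle_eq h vb0 vb2 vθ
  -- `e12` and `e13` express `Ω vζ vθ` as $1+c$ times `Ω va0 vα0` and $1+c$ times `Ω vb0 vβ0`. The
  -- latter is zero by `h₃`, whence the last relation, where $c=-1$ becomes exceptional.
  have e12 := cocycle_eq h va0 vα0 vζ
  have e13 := cocycle_eq h vb0 vβ0 vζ
  have e14 := cocycle_eq h va0 vα0 vξ
  simp only [a02, a0b1, a0ζ, a0ξ, a0θ, a0α, a0b2, a0β, b02, b0ζ, b0ξ, b0θ, b0β, b0a2,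
    b0α, a1a0, a1b2, a1β, b1b0, b1a2, b1α, a2b1, a2ζ, a2ξ, a2θ, b2ζ, b2ξ, b2θ, αζ, αξ, βζ,
    ζ1, ζ2, ζ3, ζ4, ζ5, ζ6, ζ7, ζ8, ζ9, ζ10, ζ11, z, n, h₁, h₂, h₃, s vξ vθ, s va0 vα0,
    s vb0 vβ0, s vζ vθ, mul_zero, zero_mul, one_mul, add_zero, zero_add, sub_zero, neg_zero]
    at e1 e2 e3 e4 e5 e6 e7 e8 e9 e10 e11 e12 e13 e14
  have e15 : Ω vζ vθ = 0 := by linarith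
  rw [e15] at e12
  refine ⟨⟨?_, ?_, ?_, ?_⟩, ⟨?_, ?_, ?_, ?_⟩, ⟨?_, ?_, ?_⟩, e15, ?_, ?_⟩ <;> linarith

theorem eq_zero_of_span {Ω : twoCochain ℝ 𝔤₂ ℝ} {S : Set 𝔤₂} (hS : Submodule.span ℝ S = ⊤)
    (h : ∀ X ∈ S, ∀ Y ∈ S, Ω X Y = 0) : Ω = 0 := by
  refine Subtype.ext (LinearMap.ext_on hS fun X hX => LinearMap.ext_on hS fun Y hY => ?_)
  exact h X hX Y hY

/-- A cocycle of weight zero with vanishing components at the given places is equal to zero. -/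
theorem cocycle_eq_zero {Ω : twoCochain ℝ 𝔤₂ ℝ} (h : deformedD₂₃ ℝ 𝔤₂ c ζ Ω = 0)
    (hK : ∀ X ∈ nonzeroWeight, Ω euler X = 0) (h₁ : Ω va0 va2 = 0) (h₂ : Ω vb0 vb2 = 0)
    (h₃ : Ω vb0 vβ0 = 0) (h₄ : Ω vζ vξ = 0) (h₅ : c = -1 → Ω va0 vα0 = 0) : Ω = 0 := by
  obtain ⟨⟨r1, r2, r3, r4⟩, ⟨r5, r6, r7, r8⟩, ⟨r9, r10, r11⟩, r12, r13, r14⟩ :=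
    cocycle_relations h h₁ h₂ h₃
  obtain ⟨ea0, eb0, ea1, eb1, eζ, eθ, eξ⟩ := lie_euler
  have h₆ : Ω va0 vα0 = 0 := by
    rcases mul_eq_zero.1 r14 with hc | hc
    · exact h₅ (by linarith)
    · exact hc
  rw [h₆, neg_zero] at r7
  have s : ∀ {X Y}, Ω X Y = 0 → Ω Y X = 0 := fun {X Y} hXY => by
    rw [← twoCochain_skew, hXY, neg_zero]
  have z : ∀ X, Ω X X = 0 := twoCochain_alt Ω
  have w : ∀ {Y Z : 𝔤₂} {y z : ℝ}, ⁅euler, Y⁆ = y • Y → ⁅euler, Z⁆ = z • Z → y + z ≠ 0 →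
    Ω Y Z = 0 := fun hY hZ hyz => apply_eq_zero_of_weight h hK hY hZ hyz
  have wξ : ∀ {Z : 𝔤₂} {z : ℝ}, ⁅euler, Z⁆ = z • Z → z ≠ 0 → Ω vξ Z = 0 :=
    fun hZ hz => apply_vξ_eq_zero h hK hZ hz
  -- A vector of weight $-1$ pairs nontrivially only with weight $1$, and that space is spanned by
  -- `va2`, `vb2`, `vα0`, `vβ0`.
  have hm : ∀ X, Ω X va2 = 0 → Ω X vb2 = 0 → Ω X vα0 = 0 → Ω X vβ0 = 0 →
      ⁅euler, X⁆ = (-1 : ℝ) • X → ∀ Y ∈ posVectors, Ω X Y = 0 := by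
    rintro X k1 k2 k3 k4 hX Y ⟨y, hy, hY⟩
    by_cases hy1 : y = 1
    · rw [hy1] at hY
      rw [eq_of_weight_one hY]
      simp only [map_add, map_smul, k1, k2, k3, k4, smul_zero, add_zero]
    · exact w hX hY fun h0 => hy1 (by linarith)
  have hn : ∀ X ∈ nonposVectors, ∀ Y ∈ posVectors, Ω X Y = 0 := by
    rintro X hX Y hY
    obtain ⟨y, hy, hY'⟩ := id hY
    simp only [nonposVectors, Set.mem_insert_iff, Set.mem_singleton_iff] at hX
    rcases hX with rfl | rfl | rfl | rfl | rfl | rfl | rfl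
    · exact hm _ h₁ r1 h₆ r2 ea0 Y hY
    · exact hm _ r3 h₂ r4 h₃ eb0 Y hY
    · exact w ea1 hY' (by linarith)
    · exact w eb1 hY' (by linarith)
    · exact w eζ hY' (by linarith)
    · exact wξ hY' hy.ne'
    · exact w eθ hY' (by linarith)
  have hnn : ∀ X ∈ nonposVectors, ∀ Y ∈ nonposVectors, Ω X Y = 0 := by
    have m : (-1 : ℝ) + -1 ≠ 0 := by norm_num
    have m0 : (-1 : ℝ) + 0 ≠ 0 := by norm_num
    have m1 : (-1 : ℝ) ≠ 0 := by norm_num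
    have a0b0 := w ea0 eb0 m
    have a0a1 := w ea0 ea1 m0
    have a0b1 := w ea0 eb1 m0
    have a0ζ := w ea0 eζ m0
    have a0ξ := s (wξ ea0 m1)
    have a0θ := w ea0 eθ m0
    have b0a1 := w eb0 ea1 m0
    have b0b1 := w eb0 eb1 m0
    have b0ζ := w eb0 eζ m0
    have b0ξ := s (wξ eb0 m1)
    have b0θ := w eb0 eθ m0
    intro X hX Y hY
    simp only [nonposVectors, Set.mem_insert_iff, Set.mem_singleton_iff] at hX hY
    -- Up to skew symmetry, each of the 49 pairs is diagonal, of nonzero total weight, or among the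
    -- relations in the context.
    rcases hX with rfl | rfl | rfl | rfl | rfl | rfl | rfl <;>
    rcases hY with rfl | rfl | rfl | rfl | rfl | rfl | rfl <;>
    first
      | assumption
      | exact z _
      | exact s (by assumption)
  refine eq_zero_of_span span_eq_top ?_
  rintro X (hX | hX) Y (hY | hY)
  · exact hnn X hX Y hY
  · exact hn X hX Y hY
  · exact s (hn Y hY X hX)
  · obtain ⟨x, hx, hX⟩ := hX
    obtain ⟨y, hy, hY⟩ := hY
    exact w hX hY (by linarith)

/-- Every cochain differs by a coboundary from one whose contraction with the Euler vector field is
of weight zero. -/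
theorem exists_weight_zero (Ω : twoCochain ℝ 𝔤₂ ℝ) : ∃ η : oneCochain ℝ 𝔤₂ ℝ,
    ∀ X ∈ nonzeroWeight, (Ω - deformedD₁₂ ℝ 𝔤₂ c ζ η) euler X = 0 := by
  let f : nonzeroWeight →ₗ[ℝ] 𝔤₂ := (LieModule.toEnd ℝ 𝔤₂ 𝔤₂ euler).comp nonzeroWeight.subtype
  have hf : LinearMap.ker f = ⊥ := by
    refine LinearMap.ker_eq_bot'.2 fun X hX => Subtype.ext ?_
    exact eq_zero_of_lie_euler X.2 hX
  obtain ⟨g, hg⟩ := f.exists_leftInverse_of_injective hf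
  -- `g` inverts $\mathrm{ad}\,E$ on the nonzero weights. On such $X$ both $\zeta(E)$ and $\zeta(X)$
  -- vanish, so $d_{c\zeta}\eta(E,X)=-\eta([E,X])$, which explains the sign.
  refine ⟨-((Ω euler).comp (nonzeroWeight.subtype.comp g)), fun X hX => ?_⟩
  have hgX : g ⁅euler, X⁆ = ⟨X, hX⟩ := LinearMap.congr_fun hg ⟨X, hX⟩
  change Ω euler X - deformedD₁₂ ℝ 𝔤₂ c ζ _ euler X = 0
  rw [deformedD₁₂_apply, form_euler.1, (mem_nonzeroWeight.1 hX).2.2.1]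
  simp [hgX]

/-! ### The first cohomology -/

/-- A closed form vanishes on brackets. Every eigenvector of nonzero weight is a bracket with
`euler`; `va1`, `vb1`, `vθ` are brackets up to sign; and `⁅vζ, vξ⁆ = -vξ - 2 • vθ` then handles
`vξ`. Only `vζ` is left. -/
theorem eq_smul_ζ_of_closed {f : oneCochain ℝ 𝔤₂ ℝ} (hf : d₁₂ ℝ 𝔤₂ ℝ f = 0) : f = f vζ • ζ := by
  have h : ∀ X Y, f ⁅X, Y⁆ = 0 := fun X Y => by
    rw [← neg_eq_zero, ← d₁₂_apply_apply_ofTrivial, hf]; rfl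
  have hw : ∀ {X : 𝔤₂} {w : ℝ}, w ≠ 0 → ⁅euler, X⁆ = w • X → f X = 0 := fun {X w} hw hX => by
    have := h euler X
    rw [hX, map_smul, smul_eq_mul, mul_eq_zero] at this
    exact this.resolve_left hw
  obtain ⟨ζ1, ζ2, ζ3, ζ4, -, -, -, -, ζ9, ζ10, ζ11⟩ := ζ_values
  obtain ⟨ea0, eb0, -, -, -, -, -⟩ := lie_euler
  have a0 : f va0 = 0 := hw (by norm_num) ea0
  have b0 : f vb0 = 0 := hw (by norm_num) eb0
  have a1 : f va1 = 0 := by rw [← lie_a0.1]; exact h _ _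
  have b1 : f vb1 = 0 := by rw [← lie_b0.1]; exact h _ _
  have θ : f vθ = 0 := by
    have := h va0 vα0
    rwa [lie_a0.2.2.2.2.2.1, map_neg, neg_eq_zero] at this
  have ξ : f vξ = 0 := by
    have := h vζ vξ
    rwa [lie_α0.2.2.2, map_sub, map_neg, map_smul, θ, smul_zero, sub_zero, neg_eq_zero] at this
  refine LinearMap.ext_on span_eq_top ?_
  rintro X (hX | ⟨w, hw', hX⟩)
  · simp only [nonposVectors, Set.mem_insert_iff, Set.mem_singleton_iff] at hX
    rw [LinearMap.smul_apply, smul_eq_mul]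
    rcases hX with rfl | rfl | rfl | rfl | rfl | rfl | rfl
    · rw [a0, ζ1, mul_zero]
    · rw [b0, ζ2, mul_zero]
    · rw [a1, ζ3, mul_zero]
    · rw [b1, ζ4, mul_zero]
    · rw [ζ9, mul_one]
    · rw [ξ, ζ10, mul_zero]
    · rw [θ, ζ11, mul_zero]
  · rw [hw hw'.ne' hX, LinearMap.smul_apply,
      (mem_nonzeroWeight.1 (mem_nonzeroWeight_of_lie hw'.ne' hX)).2.2.1, smul_zero]

theorem range_d₀₁ : LinearMap.range (d₀₁ ℝ 𝔤₂) = ⊥ := by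
  rw [LinearMap.range_eq_bot]
  rfl

theorem firstCohomology_mk_ζ_ne_zero : FirstCohomology.mk ℝ 𝔤₂ ζ d₁₂_ζ ≠ 0 := by
  intro h
  have h0 := (Submodule.Quotient.mk_eq_zero _).1 h
  have h1 : ζ ∈ LinearMap.range (d₀₁ ℝ 𝔤₂) := h0
  rw [range_d₀₁, Submodule.mem_bot] at h1
  have h2 : ζ vζ = 0 := LinearMap.congr_fun h1 vζ
  rw [ζ_values.2.2.2.2.2.2.2.2.1] at h2
  exact one_ne_zero h2

theorem span_firstCohomology_mk_ζ : Submodule.span ℝ {FirstCohomology.mk ℝ 𝔤₂ ζ d₁₂_ζ} = ⊤ := by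
  rw [eq_top_iff]
  intro x _
  obtain ⟨⟨f, hf⟩, rfl⟩ := Submodule.Quotient.mk_surjective _ x
  refine Submodule.mem_span_singleton.2 ⟨f vζ, ?_⟩
  change Submodule.Quotient.mk (f vζ • (⟨ζ, d₁₂_ζ⟩ : LinearMap.ker (d₁₂ ℝ 𝔤₂ ℝ))) = _
  congr 1
  exact Subtype.ext (eq_smul_ζ_of_closed hf).symm

/-! ### The second cohomology -/

theorem twoCochain_ext {Ω Ω' : twoCochain ℝ 𝔤₂ ℝ} (h : ∀ X Y, Ω X Y = Ω' X Y) : Ω = Ω' :=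
  Subtype.ext (LinearMap.ext₂ h)

theorem wedgeCochain_apply (γ δ : oneCochain ℝ 𝔤₂ ℝ) (X Y : 𝔤₂) :
    wedgeCochain ℝ 𝔤₂ γ δ X Y = γ X * δ Y - δ X * γ Y := wedge_apply γ δ X Y

/-- The values of a coboundary on pairs of vectors that determine a cocycle of weight zero. -/
theorem coboundary_values (η : oneCochain ℝ 𝔤₂ ℝ) :
    deformedD₁₂ ℝ 𝔤₂ c ζ η va0 va2 = -η va1 ∧ deformedD₁₂ ℝ 𝔤₂ c ζ η vb0 vb2 = -η vb1 ∧
    deformedD₁₂ ℝ 𝔤₂ c ζ η vb0 vβ0 = η vθ ∧ deformedD₁₂ ℝ 𝔤₂ c ζ η va0 vα0 = η vθ ∧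
    deformedD₁₂ ℝ 𝔤₂ c ζ η vζ vξ = (1 + c) * η vξ + 2 * η vθ := by
  obtain ⟨ζ1, ζ2, ζ3, ζ4, ζ5, ζ6, ζ7, ζ8, ζ9, ζ10, ζ11⟩ := ζ_values
  simp only [deformedD₁₂_apply, lie_a0.1, lie_b0.1, lie_a0.2.2.2.2.2.1, lie_b0.2.2.2.2.2.1,
    lie_α0.2.2.2, ζ1, ζ2, ζ5, ζ6, ζ7, ζ8, ζ9, ζ10, map_neg, map_sub, map_smul, smul_eq_mul]
  refine ⟨?_, ?_, ?_, ?_, ?_⟩ <;> ring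

/-- A form of weight zero with given values on `va1`, `vb1`, `vξ`, `vθ`. -/
def weightZeroForm (x y z t : ℝ) : oneCochain ℝ 𝔤₂ ℝ := x • a 1 + y • b 1 + z • ξ₃ + t • θ₀

theorem weightZeroForm_values (x y z t : ℝ) : weightZeroForm x y z t va1 = x ∧
    weightZeroForm x y z t vb1 = y ∧ weightZeroForm x y z t vξ = z ∧
    weightZeroForm x y z t vθ = t := by
  simp [weightZeroForm, va1, vb1, vξ, vθ, a, b, form_e]

/-- Subtracting such a coboundary therefore preserves the normalization obtained from
`exists_weight_zero`. -/
theorem coboundary_weightZeroForm (x y z t : ℝ) {X : 𝔤₂} (hX : X ∈ nonzeroWeight) :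
    deformedD₁₂ ℝ 𝔤₂ c ζ (weightZeroForm x y z t) euler X = 0 := by
  obtain ⟨-, -, hζ, hξ, -⟩ := mem_nonzeroWeight.1 hX
  rw [deformedD₁₂_apply, form_euler.1, hζ]
  simp only [weightZeroForm, LinearMap.add_apply, LinearMap.smul_apply, a_lie_euler, b_lie_euler,
    ξ₃_lie_euler, θ₀_lie_euler, hξ]
  simp

theorem deformedD₂₃_sub_coboundary {Ω : twoCochain ℝ 𝔤₂ ℝ} (h : deformedD₂₃ ℝ 𝔤₂ c ζ Ω = 0)
    (η : oneCochain ℝ 𝔤₂ ℝ) : deformedD₂₃ ℝ 𝔤₂ c ζ (Ω - deformedD₁₂ ℝ 𝔤₂ c ζ η) = 0 := by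
  rw [map_sub, h, deformedD₂₃_deformedD₁₂ ℝ 𝔤₂ c ζ d₁₂_ζ, sub_zero]

theorem sub_apply_apply (Ω Ω' : twoCochain ℝ 𝔤₂ ℝ) (X Y : 𝔤₂) :
    (Ω - Ω') X Y = Ω X Y - Ω' X Y := rfl

/-- Every cocycle is a coboundary if `c ≠ -1`. -/
theorem exists_eq_coboundary (hc : c ≠ -1) {Ω : twoCochain ℝ 𝔤₂ ℝ}
    (h : deformedD₂₃ ℝ 𝔤₂ c ζ Ω = 0) : ∃ η, deformedD₁₂ ℝ 𝔤₂ c ζ η = Ω := by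
  obtain ⟨η, hη⟩ := exists_weight_zero (c := c) Ω
  have hc' : 1 + c ≠ 0 := fun h0 => hc (by linarith)
  have hD := deformedD₂₃_sub_coboundary h η
  generalize hD' : Ω - deformedD₁₂ ℝ 𝔤₂ c ζ η = D at hη hD
  -- The coefficients solve the equations of `coboundary_values` at four of the five places; the one
  -- on $\xi^3$ is where $1+c\ne0$ is needed. The fifth place is then forced to vanish.
  set η' := weightZeroForm (-D va0 va2) (-D vb0 vb2)
    ((D vζ vξ - 2 * D vb0 vβ0) / (1 + c)) (D vb0 vβ0) with hη'
  obtain ⟨v1, v2, v3, v4⟩ := weightZeroForm_values (-D va0 va2) (-D vb0 vb2)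
    ((D vζ vξ - 2 * D vb0 vβ0) / (1 + c)) (D vb0 vβ0)
  rw [← hη'] at v1 v2 v3 v4
  obtain ⟨d1, d2, d3, d4, d5⟩ := coboundary_values (c := c) η'
  have h0 : D - deformedD₁₂ ℝ 𝔤₂ c ζ η' = 0 := by
    refine cocycle_eq_zero (deformedD₂₃_sub_coboundary hD η') (fun X hX => ?_) ?_ ?_ ?_ ?_
      fun h1 => absurd h1 hc
    · rw [sub_apply_apply, hη X hX, coboundary_weightZeroForm _ _ _ _ hX, sub_zero]
    · rw [sub_apply_apply, d1, v1]; ring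
    · rw [sub_apply_apply, d2, v2]; ring
    · rw [sub_apply_apply, d3, v4]; ring
    · rw [sub_apply_apply, d5, v3, v4]; field_simp; ring
  refine ⟨η + η', ?_⟩
  rw [map_add, ← sub_eq_zero.1 h0, ← hD']; abel

/-! ### The generating cocycles at $c=-1$. -/

/-- The component of weight zero of `Ω₁`. -/
def Ω₁' : twoCochain ℝ 𝔤₂ ℝ := wedgeCochain ℝ 𝔤₂ (ζ - a 1) ξ₃ - wedgeCochain ℝ 𝔤₂ (α 0) (a 0)

theorem Ω₁'_apply (X Y : 𝔤₂) : Ω₁' X Y = (ζ X - a 1 X) * ξ₃ Y - ξ₃ X * (ζ Y - a 1 Y) -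
    (α 0 X * a 0 Y - a 0 X * α 0 Y) := by
  rw [Ω₁', sub_apply_apply, wedgeCochain_apply, wedgeCochain_apply]; rfl

theorem Ω₂_apply (X Y : 𝔤₂) : Ω₂ X Y = ζ X * ξ₃ Y - ξ₃ X * ζ Y := wedgeCochain_apply _ _ X Y

/-- The part of $\Omega_1$ outside weight zero is exact, with primitive $\xi^2-\xi^1$; all
evaluations can thus be made on `Ω₁'`. -/
theorem Ω₁_eq : Ω₁ = Ω₁' + deformedD₁₂ ℝ 𝔤₂ (-1) ζ (b 0 - a 0) := by
  refine twoCochain_ext fun X Y => ?_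
  have h : Ω₁ X Y = wedgeCochain ℝ 𝔤₂ η₁ (ξ₁ + ξ₂ + ξ₃) X Y - wedgeCochain ℝ 𝔤₂ (θ₁ + ξ₂) ξ₁ X Y
    + wedgeCochain ℝ 𝔤₂ (θ₃ + ξ₃) ξ₂ X Y := rfl
  rw [h, add_apply_apply, Ω₁'_apply, deformedD₁₂_apply]
  simp only [wedgeCochain_apply, LinearMap.sub_apply, lie_eq_br, a_br, b_br, quadA_apply,
    Finset.sum_range_succ, Finset.sum_range_zero]
  simp [a, b, α, ζ]
  ring

theorem cocycle_Ω₁' : deformedD₂₃ ℝ 𝔤₂ (-1) ζ Ω₁' = 0 := by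
  refine LinearMap.ext₂ fun X Y => LinearMap.ext fun Z => ?_
  rw [deformedD₂₃_apply]
  simp only [Ω₁'_apply, lie_eq_br, ξ₃_br, a_br, α_br, quadA_apply, quadB_apply, ζ_br,
    Finset.sum_range_succ, Finset.sum_range_zero]
  norm_num
  ring

theorem cocycle_Ω₁ : deformedD₂₃ ℝ 𝔤₂ (-1) ζ Ω₁ = 0 := by
  rw [Ω₁_eq, map_add, cocycle_Ω₁', deformedD₂₃_deformedD₁₂ ℝ 𝔤₂ _ ζ d₁₂_ζ, add_zero]

theorem cocycle_Ω₂ : deformedD₂₃ ℝ 𝔤₂ (-1) ζ Ω₂ = 0 := by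
  refine LinearMap.ext₂ fun X Y => LinearMap.ext fun Z => ?_
  rw [deformedD₂₃_apply]
  simp only [Ω₂_apply, lie_eq_br, ξ₃_br, ζ_br, LinearMap.zero_apply]
  ring

theorem Ω_values : (Ω₁' va0 va2 = 0 ∧ Ω₁' vb0 vb2 = 0 ∧ Ω₁' vb0 vβ0 = 0 ∧ Ω₁' va0 vα0 = 1 ∧
    Ω₁' vζ vξ = 1) ∧ Ω₂ va0 va2 = 0 ∧ Ω₂ vb0 vb2 = 0 ∧ Ω₂ vb0 vβ0 = 0 ∧ Ω₂ va0 vα0 = 0 ∧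
    Ω₂ vζ vξ = 1 := by
  obtain ⟨ζ1, ζ2, ζ3, ζ4, ζ5, ζ6, ζ7, ζ8, ζ9, ζ10, ζ11⟩ := ζ_values
  simp only [Ω₁'_apply, Ω₂_apply, ζ1, ζ2, ζ5, ζ6, ζ7, ζ8, ζ9, ζ10]
  simp [va0, va2, vb0, vb2, vα0, vβ0, vζ, vξ, a, α, form_e]
  norm_num

theorem Ω_euler {X : 𝔤₂} (hX : X ∈ nonzeroWeight) : Ω₁' euler X = 0 ∧ Ω₂ euler X = 0 := by
  obtain ⟨ha, -, hζ, hξ, -⟩ := mem_nonzeroWeight.1 hX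
  rw [Ω₁'_apply, Ω₂_apply, ha, hζ, hξ, α_euler, a_euler (n := 0) (by omega), form_euler.1]
  simp

theorem exists_eq_add_coboundary {Ω : twoCochain ℝ 𝔤₂ ℝ}
    (h : deformedD₂₃ ℝ 𝔤₂ (-1) ζ Ω = 0) : ∃ (k l : ℝ) (η : oneCochain ℝ 𝔤₂ ℝ),
      Ω = k • Ω₁ + l • Ω₂ + deformedD₁₂ ℝ 𝔤₂ (-1) ζ η := by
  obtain ⟨η, hη⟩ := exists_weight_zero (c := -1) Ω
  have hD := deformedD₂₃_sub_coboundary h η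
  generalize hD' : Ω - deformedD₁₂ ℝ 𝔤₂ (-1) ζ η = D at hη hD
  -- At $c=-1$ the coefficient of $\xi^3$ has no effect on the five values, so it is taken to be
  -- $0$.
  set η' := weightZeroForm (-D va0 va2) (-D vb0 vb2) 0 (D vb0 vβ0) with hη'
  obtain ⟨v1, v2, -, v4⟩ := weightZeroForm_values (-D va0 va2) (-D vb0 vb2) 0 (D vb0 vβ0)
  rw [← hη'] at v1 v2 v4
  obtain ⟨d1, d2, d3, d4, d5⟩ := coboundary_values (c := -1) η'
  obtain ⟨⟨p1, p2, p3, p4, p5⟩, q1, q2, q3, q4, q5⟩ := Ω_values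
  -- The numbers $k$ and $k+l$ are the two combinations unchanged by coboundaries; $k$ is subtracted
  -- in `l` because `Ω₁'` also takes the value $1$ at `vζ`, `vξ`.
  obtain ⟨k, hk⟩ : ∃ k, k = D va0 vα0 - D vb0 vβ0 := ⟨_, rfl⟩
  obtain ⟨l, hl⟩ : ∃ l, l = D vζ vξ - 2 * D vb0 vβ0 - k := ⟨_, rfl⟩
  have hv : ∀ X Y, (D - k • Ω₁' - l • Ω₂ - deformedD₁₂ ℝ 𝔤₂ (-1) ζ η') X Y =
      D X Y - k * Ω₁' X Y - l * Ω₂ X Y - deformedD₁₂ ℝ 𝔤₂ (-1) ζ η' X Y := fun _ _ => rfl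
  have h0 : D - k • Ω₁' - l • Ω₂ - deformedD₁₂ ℝ 𝔤₂ (-1) ζ η' = 0 := by
    refine cocycle_eq_zero (c := -1) (deformedD₂₃_sub_coboundary ?_ η') (fun X hX => ?_) ?_ ?_ ?_
      ?_ fun _ => ?_
    · rw [map_sub, map_sub, map_smul, map_smul, hD, cocycle_Ω₁', cocycle_Ω₂]; simp
    · rw [hv, hη X hX, coboundary_weightZeroForm _ _ _ _ hX, (Ω_euler hX).1, (Ω_euler hX).2]
      ring
    · rw [hv, d1, v1, p1, q1]; ring
    · rw [hv, d2, v2, p2, q2]; ring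
    · rw [hv, d3, v4, p3, q3]; ring
    · rw [hv, d5, v4, p5, q5, hl]; ring
    · rw [hv, d4, v4, p4, q4, hk]; ring
  -- The last term trades `Ω₁'` for `Ω₁`, as in `Ω₁_eq`.
  refine ⟨k, l, η + η' - k • (b 0 - a 0), ?_⟩
  have h1 : Ω = D + deformedD₁₂ ℝ 𝔤₂ (-1) ζ η := by rw [← hD']; abel
  have h2 : D = k • Ω₁' + l • Ω₂ + deformedD₁₂ ℝ 𝔤₂ (-1) ζ η' := by
    rw [← sub_eq_zero, ← h0]; abel
  rw [h1, h2, Ω₁_eq, map_sub _ (η + η'), map_add, map_smul, smul_add]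
  abel

/-! ### Membership in the ideal, and the classes. -/

theorem wedgeCochain_comm (γ δ : oneCochain ℝ 𝔤₂ ℝ) :
    wedgeCochain ℝ 𝔤₂ γ δ = -wedgeCochain ℝ 𝔤₂ δ γ := by
  refine twoCochain_ext fun X Y => ?_
  change _ = -(wedgeCochain ℝ 𝔤₂ δ γ X Y)
  rw [wedgeCochain_apply, wedgeCochain_apply]; ring

theorem wedgeCochain_mem_I₂ {γ : oneCochain ℝ 𝔤₂ ℝ} (h : γ ∈ idealGenerators)
    (δ : oneCochain ℝ 𝔤₂ ℝ) :
    wedgeCochain ℝ 𝔤₂ γ δ ∈ I₂ ∧ wedgeCochain ℝ 𝔤₂ δ γ ∈ I₂ := by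
  have h1 : wedgeCochain ℝ 𝔤₂ γ δ ∈ I₂ := Submodule.subset_span ⟨γ, h, δ, rfl⟩
  exact ⟨h1, by rw [wedgeCochain_comm]; exact neg_mem h1⟩

theorem Ω₁_mem_I₂ : Ω₁ ∈ I₂ :=
  add_mem (sub_mem (wedgeCochain_mem_I₂ (by simp [idealGenerators]) _).1
    (wedgeCochain_mem_I₂ (by simp [idealGenerators]) _).2)
    (wedgeCochain_mem_I₂ (by simp [idealGenerators]) _).2

theorem Ω₂_mem_I₂ : Ω₂ ∈ I₂ := (wedgeCochain_mem_I₂ (by simp [idealGenerators]) _).2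

theorem deformedH2_mk_eq_zero {Ω : twoCochain ℝ 𝔤₂ ℝ} (h : deformedD₂₃ ℝ 𝔤₂ c ζ Ω = 0) :
    DeformedH2.mk ℝ 𝔤₂ c ζ Ω h = 0 ↔ ∃ η, deformedD₁₂ ℝ 𝔤₂ c ζ η = Ω :=
  Submodule.Quotient.mk_eq_zero _

/-- The ideal may be arbitrary, because all cocycles are exact here. -/
theorem deformedH2Part_eq_bot (hc : c ≠ -1) (I : Submodule ℝ (twoCochain ℝ 𝔤₂ ℝ)) :
    deformedH2Part ℝ 𝔤₂ c ζ I = ⊥ := by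
  rw [eq_bot_iff]
  rintro _ ⟨⟨Ω, hΩ⟩, -, rfl⟩
  exact (deformedH2_mk_eq_zero hΩ).2 (exists_eq_coboundary hc hΩ)

/-- If the combination is $d_{-\zeta}\eta$, then after passing to `Ω₁'` the values at
$(b_0,\beta_0)$ and $(a_0,\alpha_0)$ give $0=\eta'(\mathrm{vθ})=k$, and the value at $(\zeta,\xi^3)$
gives $k+l=2\eta'(\mathrm{vθ})=0$. -/
theorem linearIndependent_classes : LinearIndependent ℝ
    ![DeformedH2.mk ℝ 𝔤₂ (-1) ζ Ω₁ cocycle_Ω₁, DeformedH2.mk ℝ 𝔤₂ (-1) ζ Ω₂ cocycle_Ω₂] := by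
  rw [LinearIndependent.pair_iff]
  intro k l hkl
  have h : deformedD₂₃ ℝ 𝔤₂ (-1) ζ (k • Ω₁ + l • Ω₂) = 0 := by
    rw [map_add, map_smul, map_smul, cocycle_Ω₁, cocycle_Ω₂]; simp
  obtain ⟨η, hη⟩ := (deformedH2_mk_eq_zero h).1 hkl
  obtain ⟨η', hη'⟩ : ∃ η', η' = η - k • (b 0 - a 0) := ⟨_, rfl⟩
  have h' : deformedD₁₂ ℝ 𝔤₂ (-1) ζ η' = k • Ω₁' + l • Ω₂ := by
    rw [hη', map_sub, map_smul, hη, Ω₁_eq, smul_add]; abel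
  have hv : ∀ X Y, deformedD₁₂ ℝ 𝔤₂ (-1) ζ η' X Y = k * Ω₁' X Y + l * Ω₂ X Y := fun X Y => by
    rw [h']; rfl
  obtain ⟨-, -, d3, d4, d5⟩ := coboundary_values (c := -1) η'
  obtain ⟨⟨-, -, p3, p4, p5⟩, -, -, q3, q4, q5⟩ := Ω_values
  rw [hv, p3, q3] at d3
  rw [hv, p4, q4] at d4
  rw [hv, p5, q5] at d5
  constructor <;> linarith

/-- The two classes span all of $H^2_{-\zeta}$, so intersecting with $I$ loses nothing once both
representatives are known to lie in it. -/
theorem deformedH2Part_eq_span : deformedH2Part ℝ 𝔤₂ (-1) ζ I₂ =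
    Submodule.span ℝ {DeformedH2.mk ℝ 𝔤₂ (-1) ζ Ω₁ cocycle_Ω₁,
      DeformedH2.mk ℝ 𝔤₂ (-1) ζ Ω₂ cocycle_Ω₂} := by
  refine le_antisymm ?_ (Submodule.span_le.2 ?_)
  · rintro _ ⟨⟨Ω, hΩ⟩, -, rfl⟩
    obtain ⟨k, l, η, h⟩ := exists_eq_add_coboundary hΩ
    refine Submodule.mem_span_pair.2 ⟨k, l, ?_⟩
    rw [← sub_eq_zero]
    have h0 : deformedD₂₃ ℝ 𝔤₂ (-1) ζ (k • Ω₁ + l • Ω₂ - Ω) = 0 := by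
      rw [map_sub, map_add, map_smul, map_smul, cocycle_Ω₁, cocycle_Ω₂, hΩ]; simp
    refine (deformedH2_mk_eq_zero h0).2 ⟨-η, ?_⟩
    rw [map_neg, h]; abel
  · rintro _ (rfl | rfl)
    · exact ⟨⟨Ω₁, cocycle_Ω₁⟩, Ω₁_mem_I₂, rfl⟩
    · exact ⟨⟨Ω₂, cocycle_Ω₂⟩, Ω₂_mem_I₂, rfl⟩

theorem finrank_deformedH2Part :
    Module.finrank ℝ (deformedH2Part ℝ 𝔤₂ (-1) ζ I₂) = 2 := by
  have h := finrank_span_eq_card linearIndependent_classes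
  rw [Matrix.range_cons, Matrix.range_cons, Matrix.range_empty, Set.union_empty] at h
  rw [deformedH2Part_eq_span]
  exact h

end BoyerFinley

end

theorem mainTheorem2 :
    (∃ hζ : LieModule.Cohomology.d₁₂ ℝ BoyerFinley.𝔤₂ ℝ BoyerFinley.ζ = 0,
      FirstCohomology.mk ℝ BoyerFinley.𝔤₂ BoyerFinley.ζ hζ ≠ 0 ∧
      Submodule.span ℝ {FirstCohomology.mk ℝ BoyerFinley.𝔤₂ BoyerFinley.ζ hζ} = ⊤) ∧
    (∀ lam : ℝ, lam ≠ -1 →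
      deformedH2Part ℝ BoyerFinley.𝔤₂ lam BoyerFinley.ζ BoyerFinley.I₂ = ⊥) ∧
    Module.finrank ℝ
      (deformedH2Part ℝ BoyerFinley.𝔤₂ (-1) BoyerFinley.ζ BoyerFinley.I₂) = 2 ∧
    ∃ (h₁ : deformedD₂₃ ℝ BoyerFinley.𝔤₂ (-1) BoyerFinley.ζ BoyerFinley.Ω₁ = 0)
      (h₂ : deformedD₂₃ ℝ BoyerFinley.𝔤₂ (-1) BoyerFinley.ζ BoyerFinley.Ω₂ = 0),
      BoyerFinley.Ω₁ ∈ BoyerFinley.I₂ ∧ BoyerFinley.Ω₂ ∈ BoyerFinley.I₂ ∧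
      LinearIndependent ℝ
        ![DeformedH2.mk ℝ BoyerFinley.𝔤₂ (-1) BoyerFinley.ζ BoyerFinley.Ω₁ h₁,
          DeformedH2.mk ℝ BoyerFinley.𝔤₂ (-1) BoyerFinley.ζ BoyerFinley.Ω₂ h₂] ∧
      deformedH2Part ℝ BoyerFinley.𝔤₂ (-1) BoyerFinley.ζ BoyerFinley.I₂ =
        Submodule.span ℝ
          {DeformedH2.mk ℝ BoyerFinley.𝔤₂ (-1) BoyerFinley.ζ BoyerFinley.Ω₁ h₁,
            DeformedH2.mk ℝ BoyerFinley.𝔤₂ (-1) BoyerFinley.ζ BoyerFinley.Ω₂ h₂} := by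
  exact ⟨⟨BoyerFinley.d₁₂_ζ, BoyerFinley.firstCohomology_mk_ζ_ne_zero,
      BoyerFinley.span_firstCohomology_mk_ζ⟩,
    fun _ hlam => BoyerFinley.deformedH2Part_eq_bot hlam _, BoyerFinley.finrank_deformedH2Part,
    BoyerFinley.cocycle_Ω₁, BoyerFinley.cocycle_Ω₂, BoyerFinley.Ω₁_mem_I₂,
    BoyerFinley.Ω₂_mem_I₂, BoyerFinley.linearIndependent_classes,
    BoyerFinley.deformedH2Part_eq_span⟩
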